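/- Let $K$ be a field of characteristic $0$. **The category $\mathbf A^L$.** Its objects are the elements of the free monoid (written $\otimes$, with unit $I$) on two letters $H$ and $L$. Let $w$ and $w'$ be objects, with $m$ and $m'$ letters $H$ and $p$ and $p'$ letters $L$, respectively. A *$(w,w')$-diagram* is a Jacobi diagram (a finite uni-trivalent graph with a cyclic order at each trivalent vertex) mapped into the handlebody $U_m$ of genus $m$ together with $m'$ oriented arcs $X_{m'}$, whose endpoints are fixed on the bottom line of $U_m$; $p$ of the univalent vertices are attached bijectively to $p$ fixed points of the upper line of $U_m$, $p'$ of them bijectively to $p'$ fixed points of the bottom line, and the remaining ones to distinct interior points of $X_{m'}$. Every connected component of the Jacobi diagram is required to meet the bottom line or $X_{m'}$, and diagrams are considered up to homotopy relative to the fixed points. The space $\mathbf A^L(w,w')$ is the $K$-vector space spanned by the $(w,w')$-diagrams modulo the STU, AS and IHX relations. The composite $D'\circ D$ of $D\colon w\to w'$ and $D'\colon w'\to w''$ is obtained by stacking a suitable cabling of $D$ and $D'$: each passage of a curve of $D'$ through the $j$-th handle of $U_{m'}$ is replaced by a parallel copy of the $j$-th arc of $D$ (reversed if the passage is negative), each univalent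 vertex of $D$ on the $j$-th arc is replaced by the sum of all ways to attach it to one of these parallel copies, with sign $-1$ for each attachment to a reversed copy, and the bottom endpoints of $D$ are joined to the upper endpoints of $D'$. With this composition $\mathbf A^L$ is a $K$-linear category. Let $\mathbf A$ (Jacobi diagrams in handlebodies) and $\mathrm{Cat}_{\mathrm{Lie}^C}$ (the $K$-linear PROP for Casimir Lie algebras) be the full subcategories of $\mathbf A^L$ on the objects $H^{\otimes n}$ and $L^{\otimes m}$ $(n,m\ge 0)$, respectively. For a $K$-linear category $\mathcal C$, a *$\mathcal C$-module* is a $K$-linear functor from $\mathcal C$ to $K$-vector spaces, and $\mathcal C\text{-}\mathrm{Mod}$ is the category of $\mathcal C$-modules and natural transformations. For $K$-linear categories $\mathcal A,\mathcal C$, an *$(\mathcal A,\mathcal C)$-bimodule* is a functor $B$ from $\mathcal C^{\mathrm{op}}\times\mathcal A$ to $K$-vector spaces that is $K$-linear in each variable. For a $\mathcal C$-module $N$, let $B\otimes_{\mathcal C}N$ be the $\mathcal A$-module $$a\longmapsto \Bigl(\bigoplus_{c} B(c,a)\otimes_K N(c)\Bigr)\Big/\bigl\langle (b\cdot f)\otimes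 x-b\otimes (f\cdot x)\ :\ f\in\mathcal C(c,c'),\ b\in B(c',a),\ x\in N(c)\bigr\rangle ,$$ and for an $\mathcal A$-module $M$ let $\mathrm{Hom}_{\mathcal A\text{-}\mathrm{Mod}}(B,M)$ be the $\mathcal C$-module $c\mapsto \mathrm{Hom}_{\mathcal A\text{-}\mathrm{Mod}}(B(c,-),M)$. **Theorem.** The spaces $\mathbf A^L(L^{\otimes m},H^{\otimes n})$, with the two actions given by composition in $\mathbf A^L$, form an $(\mathbf A,\mathrm{Cat}_{\mathrm{Lie}^C})$-bimodule $\mathbf A^L(L^{\otimes -},H^{\otimes -})$, and there is an adjunction $$\mathbf A^L(L^{\otimes -},H^{\otimes -})\otimes_{\mathrm{Cat}_{\mathrm{Lie}^C}}-\ \dashv\ \mathrm{Hom}_{\mathbf A\text{-}\mathrm{Mod}}\bigl(\mathbf A^L(L^{\otimes -},H^{\otimes -}),-\bigr)$$ between $\mathrm{Cat}_{\mathrm{Lie}^C}\text{-}\mathrm{Mod}$ (the source of the left adjoint) and $\mathbf A\text{-}\mathrm{Mod}$, under which a morphism $\varphi\colon \mathbf A^L(L^{\otimes -},H^{\otimes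 -})\otimes_{\mathrm{Cat}_{\mathrm{Lie}^C}} N\to M$ corresponds to the morphism that sends $x\in N(m)$ to $\bigl(b\mapsto \varphi(b\otimes x)\bigr)$, for $b\in \mathbf A^L(L^{\otimes m},H^{\otimes n})$. -/

import Mathlib

/- Extended Jacobi diagrams in handlebodies, up to homotopy, are encoded combinatorially.

A diagram from the object `w` to the object `w'` lives in the handlebody with one handle for each
letter `H` of `w`.  It has a solid oriented arc for each letter `H` of `w'`, an endpoint on the upper
line for each letter `L` of `w`, and an endpoint on the bottom line for each letter `L` of `w'`.
The dashed part is cut into finitely many *strands* (oriented dashed intervals).  Along a strand or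
a solid arc one reads, in the direction of the orientation, a finite word whose letters are

* passages: the curve runs once through a handle, in positive or negative direction;
* pins: points of the curve at which another dashed edge is attached.

The half-edges (flags) are the two ends of each strand, the pins, and the points of the upper and of
the bottom line; a fixed-point free involution `mate` joins them in pairs.  A pin on a strand is a
trivalent vertex; its cyclic order is (incoming end, outgoing end, attached edge) of the strand.
A pin on a solid arc is a univalent vertex of the dashed graph on that arc.  A strand
without pins is just a piece of a dashed edge, so every edge of a Jacobi diagram can carry passages
after inserting such strands.  The handlebody is aspherical with free fundamental group on its
handles, so that homotopy classes of curves are the words in the passages, up to cancellation and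
up to sliding vertices through handles. -/

universe u
open CategoryTheory

namespace ExtJac

/-- The two generating objects. -/
inductive Gen : Type
  | H : Gen
  | L : Gen

/-- Objects of the category of extended Jacobi diagrams: words in `H` and `L`. -/
abbrev Obj : Type := FreeMonoid Gen

/-- The letters `H` of a word.  They index the handles of the handlebody at the source and
the solid arcs at the target. -/
def Handle (w : Obj) : Type := {i : Fin w.toList.length // w.toList.get i = Gen.H}

/-- The letters `L` of a word.  They index the points of the upper line at the source and of the
bottom line at the target. -/
def Pt (w : Obj) : Type := {i : Fin w.toList.length // w.toList.get i = Gen.L}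

instance (w : Obj) : Finite (Handle w) := inferInstanceAs (Finite {i : Fin w.toList.length // w.toList.get i = Gen.H})
instance (w : Obj) : Finite (Pt w) := inferInstanceAs (Finite {i : Fin w.toList.length // w.toList.get i = Gen.L})

/-- Half-edges of the dashed graph, with strands `S`, pins `P`, upper points `T` and bottom
points `B`. -/
inductive Flag (S P T B : Type) : Type
  | src : S → Flag S P T B
  | tgt : S → Flag S P T B
  | pin : P → Flag S P T B
  | top : T → Flag S P T B
  | bot : B → Flag S P T B

/-- The strand to which a half-edge belongs, if there is one. -/
def onStrand {S P Q A T B : Type} (loc : Q ⊕ P → S ⊕ A) : Flag S P T B → Option S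
  | .src s => some s
  | .tgt s => some s
  | .pin p => (loc (.inr p)).getLeft?
  | .top _ => none
  | .bot _ => none

/-- The half-edge lies in a connected component of the dashed graph that meets the bottom line or
a solid arc. -/
inductive Anchored {S P Q A T B : Type} (loc : Q ⊕ P → S ⊕ A)
    (mate : Flag S P T B → Flag S P T B) : Flag S P T B → Prop
  | bot (b : B) : Anchored loc mate (.bot b)
  | arc (p : P) (j : A) (h : loc (.inr p) = .inr j) : Anchored loc mate (.pin p)
  | edge (f : Flag S P T B) (h : Anchored loc mate (mate f)) : Anchored loc mate f
  | strand (f g : Flag S P T B) (s : S) (hf : onStrand loc f = some s)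
      (hg : onStrand loc g = some s) (h : Anchored loc mate f) : Anchored loc mate g

/-- A diagram from `w` to `w'` with set `S` of strands, `P` of pins and `Q` of handle passages.
`loc` tells on which strand or solid arc a passage or pin lies, `word` lists the passages and pins of
each strand and arc in order, and `passage` records the handle and the direction of a passage.
Every component of the dashed graph meets the bottom line or a solid arc. -/
structure Diag (S P Q : Type) (w w' : Obj) : Type where
  passage : Q → Handle w × ℤˣ
  loc : Q ⊕ P → S ⊕ Handle w'
  word : S ⊕ Handle w' → List (Q ⊕ P)
  nodup : ∀ k, (word k).Nodup
  mem_word : ∀ k a, a ∈ word k ↔ loc a = k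
  mate : Flag S P (Pt w) (Pt w') → Flag S P (Pt w) (Pt w')
  mate_mate : ∀ f, mate (mate f) = f
  mate_ne : ∀ f, mate f ≠ f
  anchored : ∀ f, Anchored loc mate f

namespace Diag

variable {S P Q S' P' Q' : Type} {w w' w'' : Obj}

/-- The word of a strand or solid arc, with passages named by handle and direction. -/
def spell (D : Diag S P Q w w') (k : S ⊕ Handle w') : List ((Handle w × ℤˣ) ⊕ P) :=
  (D.word k).map (Sum.map D.passage id)

/-- Composition of `D` from `w` to `w'` with `D'` from `w'` to `w''`: every passage `q` of `D'`
through handle `j` is replaced by a parallel copy of the solid arc `j` of `D`, reversed if the passage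
is negative, and the strands of `D` are kept.  `Adm l o`: an item located at `l` in `D` has a
copy with label `o`; items of strands have only the copy `none`, items of arc `j` have one copy for
each passage `q` through handle `j`. -/
def Adm (D' : Diag S' P' Q' w' w'') : S ⊕ Handle w' → Option Q' → Prop
  | .inl _, none => True
  | .inr j, some q => (D'.passage q).1 = j
  | _, _ => False

/-- A pin on an arc of `D` is attached to the sum of its possible positions on the
parallel copies of this arc (the box notation, or iterated coproduct); a choice picks one position
for each pin.  Pins on strands have no choice. -/
abbrev Choice (D : Diag S P Q w w') (D' : Diag S' P' Q' w' w'') : Type :=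
  {φ : P → Option Q' // ∀ p, D'.Adm (D.loc (.inr p)) (φ p)}

/-- The passages of the composite: the passages on strands of `D`, and all copies of the passages
on solid arcs of `D`. -/
abbrev NewQ (D : Diag S P Q w w') (D' : Diag S' P' Q' w' w'') : Type :=
  {x : Q × Option Q' // D'.Adm (D.loc (.inl x.1)) x.2}

section glue

variable (D : Diag S P Q w w') (D' : Diag S' P' Q' w' w'') (φ : Choice D D')

/-- A copy of a passage on a reversed parallel arc is run through backwards. -/
def newPassage (x : NewQ D D') : Handle w × ℤˣ :=
  ((D.passage x.1.1).1, (x.1.2.elim 1 fun q => (D'.passage q).2) * (D.passage x.1.1).2)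

open Classical in
/-- The copy with label `o` of an item of `D`, if it is present for the choice `φ`. -/
noncomputable def copy (o : Option Q') : Q ⊕ P → Option (NewQ D D' ⊕ (P ⊕ P'))
  | .inl q => if h : D'.Adm (D.loc (.inl q)) o then some (.inl ⟨(q, o), h⟩) else none
  | .inr p => if φ.1 p = o then some (.inr (.inl p)) else none

/-- A word, reversed if the sign is negative. -/
def orient {α : Type} (e : ℤˣ) (l : List α) : List α := if e = 1 then l else l.reverse

/-- Replacement of the items of `D'`: a passage becomes a parallel copy of an arc of `D`. -/
noncomputable def expand : Q' ⊕ P' → List (NewQ D D' ⊕ (P ⊕ P'))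
  | .inl q => orient (D'.passage q).2
      ((D.word (.inr (D'.passage q).1)).filterMap (copy D D' φ (some q)))
  | .inr p => [.inr (.inr p)]

/-- The words of the composite.  Its strands are those of `D` and of `D'`, and one more strand
(without letters) for each letter `L` of `w'`, which joins the bottom line of `D` to the upper line
of `D'`. -/
noncomputable def newWord :
    (S ⊕ (S' ⊕ Pt w')) ⊕ Handle w'' → List (NewQ D D' ⊕ (P ⊕ P'))
  | .inl (.inl s) => (D.word (.inl s)).filterMap (copy D D' φ none)
  | .inl (.inr (.inl s)) => (D'.word (.inl s)).flatMap (expand D D' φ)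
  | .inl (.inr (.inr _)) => []
  | .inr k => (D'.word (.inr k)).flatMap (expand D D' φ)

/-- Location in the composite of what lies on a strand or arc of `D'`. -/
def upLoc : S' ⊕ Handle w'' → (S ⊕ (S' ⊕ Pt w')) ⊕ Handle w'' :=
  Sum.map (fun s => .inr (.inl s)) id

/-- Location in the composite of a copy with label `o` of an item located at `l` in `D`. -/
def place (D' : Diag S' P' Q' w' w'') : (l : S ⊕ Handle w') → (o : Option Q') → D'.Adm l o →
    (S ⊕ (S' ⊕ Pt w')) ⊕ Handle w''
  | .inl s, none, _ => .inl (.inl s)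
  | .inr _, some q, _ => upLoc (D'.loc (.inl q))
  | .inl _, some _, h => h.elim
  | .inr _, none, h => h.elim

theorem place_some (l : S ⊕ Handle w') (q : Q') (h : D'.Adm l (some q)) :
    D'.place l (some q) h = upLoc (D'.loc (.inl q)) := by
  rcases l with s | j
  · exact h.elim
  · rfl

theorem place_congr {l l' : S ⊕ Handle w'} {o o' : Option Q'} (h : D'.Adm l o) (hl : l = l')
    (ho : o = o') : D'.place l o h = D'.place l' o' (hl ▸ ho ▸ h) := by
  subst hl; subst ho; rfl

/-- Location of the items of the composite. -/
def newLoc : NewQ D D' ⊕ (P ⊕ P') → (S ⊕ (S' ⊕ Pt w')) ⊕ Handle w''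
  | .inl x => D'.place (D.loc (.inl x.1.1)) x.1.2 x.2
  | .inr (.inl p) => D'.place (D.loc (.inr p)) (φ.1 p) (φ.2 p)
  | .inr (.inr p) => upLoc (D'.loc (.inr p))

/-- The half-edges of `D` in the composite. -/
def lowFlag : Flag S P (Pt w) (Pt w') →
    Flag (S ⊕ (S' ⊕ Pt w')) (P ⊕ P') (Pt w) (Pt w'')
  | .src s => .src (.inl s)
  | .tgt s => .tgt (.inl s)
  | .pin p => .pin (.inl p)
  | .top t => .top t
  | .bot b => .src (.inr (.inr b))

/-- The half-edges of `D'` in the composite. -/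
def highFlag : Flag S' P' (Pt w') (Pt w'') →
    Flag (S ⊕ (S' ⊕ Pt w')) (P ⊕ P') (Pt w) (Pt w'')
  | .src s => .src (.inr (.inl s))
  | .tgt s => .tgt (.inr (.inl s))
  | .pin p => .pin (.inr p)
  | .top t => .tgt (.inr (.inr t))
  | .bot b => .bot b

/-- The pairing of half-edges of the composite. -/
def newMate : Flag (S ⊕ (S' ⊕ Pt w')) (P ⊕ P') (Pt w) (Pt w'') →
    Flag (S ⊕ (S' ⊕ Pt w')) (P ⊕ P') (Pt w) (Pt w'')
  | .src (.inl s) => lowFlag (D.mate (.src s))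
  | .tgt (.inl s) => lowFlag (D.mate (.tgt s))
  | .pin (.inl p) => lowFlag (D.mate (.pin p))
  | .top t => lowFlag (D.mate (.top t))
  | .src (.inr (.inr t)) => lowFlag (D.mate (.bot t))
  | .src (.inr (.inl s)) => highFlag (D'.mate (.src s))
  | .tgt (.inr (.inl s)) => highFlag (D'.mate (.tgt s))
  | .pin (.inr p) => highFlag (D'.mate (.pin p))
  | .tgt (.inr (.inr t)) => highFlag (D'.mate (.top t))
  | .bot b => highFlag (D'.mate (.bot b))

theorem newMate_low (f) : newMate D D' (lowFlag f) = lowFlag (D.mate f) := by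
  cases f <;> rfl
theorem newMate_high (f) : newMate D D' (highFlag f) = highFlag (D'.mate f) := by
  cases f <;> rfl
theorem low_or_high (f : Flag (S ⊕ (S' ⊕ Pt w')) (P ⊕ P') (Pt w) (Pt w'')) :
    (∃ g : Flag S P (Pt w) (Pt w'), f = lowFlag g) ∨
      ∃ g : Flag S' P' (Pt w') (Pt w''), f = highFlag g := by
  rcases f with (s | s | t) | (s | s | t) | (p | p) | t | b
  · exact .inl ⟨.src s, rfl⟩
  · exact .inr ⟨.src s, rfl⟩
  · exact .inl ⟨.bot t, rfl⟩
  · exact .inl ⟨.tgt s, rfl⟩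
  · exact .inr ⟨.tgt s, rfl⟩
  · exact .inr ⟨.top t, rfl⟩
  · exact .inl ⟨.pin p, rfl⟩
  · exact .inr ⟨.pin p, rfl⟩
  · exact .inl ⟨.top t, rfl⟩
  · exact .inr ⟨.bot b, rfl⟩
theorem low_injective : Function.Injective
    (lowFlag : Flag S P (Pt w) (Pt w') →
      Flag (S ⊕ (S' ⊕ Pt w')) (P ⊕ P') (Pt w) (Pt w'')) := by
  intro f g h; cases f <;> cases g <;> simp_all [lowFlag]
theorem high_injective : Function.Injective
    (highFlag : Flag S' P' (Pt w') (Pt w'') →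
      Flag (S ⊕ (S' ⊕ Pt w')) (P ⊕ P') (Pt w) (Pt w'')) := by
  intro f g h; cases f <;> cases g <;> simp_all [highFlag]

theorem mem_orient {α : Type} (e : ℤˣ) (l : List α) (a : α) : a ∈ orient e l ↔ a ∈ l := by
  unfold orient; split <;> simp
theorem nodup_orient {α : Type} (e : ℤˣ) (l : List α) : (orient e l).Nodup ↔ l.Nodup := by
  unfold orient; split <;> simp

/-- The item of the second diagram from which an item of the composite arises. -/
def origin : NewQ D D' ⊕ (P ⊕ P') → Option (Q' ⊕ P')
  | .inl x => x.1.2.map .inl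
  | .inr (.inl p) => (φ.1 p).map .inl
  | .inr (.inr p) => some (.inr p)

/-- The item of the first diagram that is copied. -/
def base : NewQ D D' ⊕ (P ⊕ P') → Option (Q ⊕ P)
  | .inl x => some (.inl x.1.1)
  | .inr (.inl p) => some (.inr p)
  | .inr (.inr _) => none

theorem copy_eq_some (o : Option Q') (a : Q ⊕ P) (x) :
    copy D D' φ o a = some x ↔ base D D' x = some a ∧ origin D D' φ x = o.map .inl := by
  have hi : Function.Injective (Option.map (Sum.inl : Q' → Q' ⊕ P')) :=
    Option.map_injective Sum.inl_injective
  rcases a with q | p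
  · rcases x with ⟨⟨q₁, o₁⟩, hx⟩ | p | p
    · simp only [copy, base, origin, hi.eq_iff]
      split_ifs with h
      · simp only [Option.some.injEq, Sum.inl.injEq, Subtype.mk.injEq, Prod.mk.injEq]
        rw [eq_comm (a := q), eq_comm (a := o)]
      · simp only [false_iff, Option.some.injEq, Sum.inl.injEq, not_and]
        rintro rfl rfl
        exact h hx
    · simp only [copy, base]; split_ifs <;> simp
    · simp only [copy, base]; split_ifs <;> simp
  · rcases x with ⟨⟨q₁, o₁⟩, hx⟩ | p | p
    · simp only [copy, base]; split_ifs <;> simp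
    · simp only [copy, base, origin, hi.eq_iff]
      split_ifs with h
      · simp only [Option.some.injEq, Sum.inr.injEq, Sum.inl.injEq]
        constructor
        · rintro rfl; exact ⟨rfl, h⟩
        · rintro ⟨rfl, -⟩; rfl
      · simp only [false_iff, Option.some.injEq, Sum.inr.injEq, not_and]
        rintro rfl h'; exact h h'
    · simp only [copy, base]; split_ifs <;> simp

theorem base_origin_inj (x y) (a : Q ⊕ P) (h₁ : base D D' x = some a) (h₂ : base D D' y = some a)
    (h : origin D D' φ x = origin D D' φ y) : x = y := by
  have hi : Function.Injective (Option.map (Sum.inl : Q' → Q' ⊕ P')) :=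
    Option.map_injective Sum.inl_injective
  rcases x with ⟨⟨q₁, o₁⟩, hx⟩ | p | p <;> rcases y with ⟨⟨q₂, o₂⟩, hy⟩ | p' | p' <;>
    simp only [base, origin, hi.eq_iff, Option.some.injEq, reduceCtorEq] at h₁ h₂ h
  · subst h; subst h₁; simp at h₂; subst h₂; rfl
  · subst h₁; simp at h₂
  · subst h₁; simp at h₂
  · subst h₁; simp at h₂; subst h₂; rfl

theorem adm_of_base (x) (a : Q ⊕ P) (h : base D D' x = some a) (o : Option Q')
    (ho : origin D D' φ x = o.map .inl) : D'.Adm (D.loc a) o := by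
  have hi : Function.Injective (Option.map (Sum.inl : Q' → Q' ⊕ P')) :=
    Option.map_injective Sum.inl_injective
  rcases x with ⟨⟨q₁, o₁⟩, hx⟩ | p | p <;>
    simp only [base, origin, hi.eq_iff, Option.some.injEq, reduceCtorEq] at h ho
  · subst ho; subst h; exact hx
  · subst ho; subst h; exact φ.2 p

theorem newLoc_eq_place (x) (a : Q ⊕ P) (h : base D D' x = some a) (o : Option Q')
    (ho : origin D D' φ x = o.map .inl) :
    newLoc D D' φ x = D'.place (D.loc a) o (adm_of_base D D' φ x a h o ho) := by
  have hi : Function.Injective (Option.map (Sum.inl : Q' → Q' ⊕ P')) :=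
    Option.map_injective Sum.inl_injective
  rcases x with ⟨⟨q₁, o₁⟩, hx⟩ | p | p <;>
    simp only [base, origin, hi.eq_iff, Option.some.injEq, reduceCtorEq] at h ho
  · subst ho; subst h; rfl
  · subst ho; subst h; rfl

theorem mem_expand (a : Q' ⊕ P') (x) : x ∈ expand D D' φ a ↔ origin D D' φ x = some a := by
  rcases a with q | p
  · simp only [expand, mem_orient, List.mem_filterMap, copy_eq_some]
    constructor
    · rintro ⟨a, -, -, h⟩; exact h
    · intro h
      obtain ⟨a, ha⟩ : ∃ a, base D D' x = some a := by
        rcases x with x | p | p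
        · exact ⟨_, rfl⟩
        · exact ⟨_, rfl⟩
        · simp [origin] at h
      refine ⟨a, ?_, ha, h⟩
      have := adm_of_base D D' φ x a ha (some q) h
      rw [D.mem_word]
      revert this
      rcases D.loc a with s | j
      · exact False.elim
      · intro h; exact congrArg Sum.inr h.symm
  · simp only [expand, List.mem_singleton]
    constructor
    · rintro rfl; rfl
    · intro h
      rcases x with ⟨⟨q, o⟩, hx⟩ | p | p
      · cases o <;> simp [origin] at h
      · simp only [origin] at h
        cases h' : φ.1 p <;> simp [h'] at h
      · simp only [origin, Option.some.injEq, Sum.inr.injEq] at h; rw [h]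

theorem newLoc_of_origin (x) (a : Q' ⊕ P') (h : origin D D' φ x = some a) :
    newLoc D D' φ x = upLoc (D'.loc a) := by
  rcases x with ⟨⟨q, o⟩, hx⟩ | p | p
  · cases o with
    | none => simp [origin] at h
    | some q' =>
      simp only [origin, Option.map_some, Option.some.injEq] at h
      subst h
      exact place_some D' _ _ _
  · rcases h' : φ.1 p with _ | q'
    · simp [origin, h'] at h
    · simp only [origin, h', Option.map_some, Option.some.injEq] at h
      subst h
      exact (place_congr D' (φ.2 p) rfl h').trans (place_some D' _ _ _)
  · simp only [origin, Option.some.injEq] at h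
    subst h; rfl

theorem newLoc_of_origin_none (x) (h : origin D D' φ x = none) :
    ∃ a s, base D D' x = some a ∧ D.loc a = .inl s ∧ newLoc D D' φ x = .inl (.inl s) := by
  obtain ⟨a, ha⟩ : ∃ a, base D D' x = some a := by
    rcases x with x | p | p
    · exact ⟨_, rfl⟩
    · exact ⟨_, rfl⟩
    · simp [origin] at h
  have h1 := newLoc_eq_place D D' φ x a ha none h
  have h2 := adm_of_base D D' φ x a ha none h
  revert h2
  rcases hl : D.loc a with s | j
  · intro _
    refine ⟨a, s, ha, hl, ?_⟩
    rw [h1, place_congr D' _ hl rfl]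
    rfl
  · exact False.elim

theorem newWord_nodup (k) : (newWord D D' φ k).Nodup := by
  have hf : ∀ l : List (Q' ⊕ P'), l.Nodup → (l.flatMap (expand D D' φ)).Nodup := by
    intro l hl
    rw [List.nodup_flatMap]
    refine ⟨?_, ?_⟩
    · rintro (q | p) -
      · rw [expand, nodup_orient]
        refine List.Nodup.filterMap ?_ (D.nodup _)
        intro a a' b hb hb'
        have h1 := (copy_eq_some D D' φ _ _ _).1 hb
        have h2 := (copy_eq_some D D' φ _ _ _).1 hb'
        exact Option.some.inj (h1.1.symm.trans h2.1)
      · simp [expand]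
    · refine hl.imp ?_
      intro a b hab x hx hx'
      rw [mem_expand] at hx hx'
      exact hab (Option.some.inj (hx.symm.trans hx'))
  rcases k with (s | s | t) | k
  · refine List.Nodup.filterMap ?_ (D.nodup _)
    intro a a' b hb hb'
    have h1 := (copy_eq_some D D' φ _ _ _).1 hb
    have h2 := (copy_eq_some D D' φ _ _ _).1 hb'
    exact Option.some.inj (h1.1.symm.trans h2.1)
  · exact hf _ (D'.nodup _)
  · exact List.nodup_nil
  · exact hf _ (D'.nodup _)

theorem mem_newWord (k) (x) : x ∈ newWord D D' φ k ↔ newLoc D D' φ x = k := by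
  have hf : ∀ l : S' ⊕ Handle w'', x ∈ (D'.word l).flatMap (expand D D' φ) ↔
      newLoc D D' φ x = upLoc l := by
    intro l
    simp only [List.mem_flatMap, mem_expand, D'.mem_word]
    constructor
    · rintro ⟨a, ha, h⟩
      rw [newLoc_of_origin D D' φ x a h, ha]
    · intro h
      rcases ho : origin D D' φ x with _ | a
      · obtain ⟨a, s, -, -, h'⟩ := newLoc_of_origin_none D D' φ x ho
        rw [h'] at h
        rcases l with l | l <;> simp [upLoc] at h
      · refine ⟨a, ?_, rfl⟩
        rw [newLoc_of_origin D D' φ x a ho] at h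
        refine (Function.Injective.sumMap ?_ Function.injective_id) h
        intro s t hst; simpa using hst
  rcases k with (s | s | t) | k
  · simp only [newWord, List.mem_filterMap, copy_eq_some, D.mem_word]
    constructor
    · rintro ⟨a, ha, hb, ho⟩
      obtain ⟨a', s', ha', hs', h⟩ := newLoc_of_origin_none D D' φ x ho
      rw [hb] at ha'; cases ha'
      rw [ha] at hs'; cases hs'
      exact h
    · intro h
      rcases ho : origin D D' φ x with _ | a
      · obtain ⟨a, s', ha, hs', h'⟩ := newLoc_of_origin_none D D' φ x ho
        rw [h] at h'; cases h'
        exact ⟨a, hs', ha, rfl⟩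
      · rw [newLoc_of_origin D D' φ x a ho] at h
        rcases hl : D'.loc a with l | l <;> simp [upLoc, hl] at h
  · exact hf (.inl s)
  · simp only [newWord, List.not_mem_nil, false_iff]
    intro h
    rcases ho : origin D D' φ x with _ | a
    · obtain ⟨a, s', ha, hs', h'⟩ := newLoc_of_origin_none D D' φ x ho
      rw [h] at h'; cases h'
    · rw [newLoc_of_origin D D' φ x a ho] at h
      rcases hl : D'.loc a with l | l <;> simp [upLoc, hl] at h
  · exact hf (.inr k)

theorem anchored_high (f : Flag S' P' (Pt w') (Pt w'')) :
    Anchored (newLoc D D' φ) (newMate D D') (highFlag f) := by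
  induction D'.anchored f with
  | bot b => exact .bot b
  | arc p j h =>
    refine .arc (Sum.inr p) j ?_
    simp [newLoc, h, upLoc]
  | edge f _ ih =>
    refine .edge _ ?_
    rw [newMate_high]; exact ih
  | strand f g s hf hg _ ih =>
    have key : ∀ f : Flag S' P' (Pt w') (Pt w''), onStrand D'.loc f = some s →
        onStrand (newLoc D D' φ) (highFlag f : Flag _ _ (Pt w) _) = some (.inr (.inl s)) := by
      intro f hf
      rcases f with s | s | p | t | b
      · simp only [onStrand, Option.some.injEq] at hf; subst hf; rfl
      · simp only [onStrand, Option.some.injEq] at hf; subst hf; rfl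
      · simp only [onStrand] at hf
        simp only [highFlag, onStrand, newLoc]
        rcases h : D'.loc (.inr p) with l | l <;> rw [h] at hf
        · simp at hf; subst hf; rfl
        · simp at hf
      · simp [onStrand] at hf
      · simp [onStrand] at hf
    exact .strand _ _ _ (key f hf) (key g hg) ih

theorem anchored_low (f : Flag S P (Pt w) (Pt w')) :
    Anchored (newLoc D D' φ) (newMate D D') (lowFlag f) := by
  induction D.anchored f with
  | bot b => exact .strand _ _ (Sum.inr (Sum.inr b)) rfl rfl (anchored_high D D' φ (.top b))
  | arc p j h =>
    have hp := φ.2 p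
    rcases ho : φ.1 p with _ | q
    · rw [h, ho] at hp; exact hp.elim
    · have hl := newLoc_of_origin D D' φ (.inr (.inl p)) (.inl q) (by simp [origin, ho])
      rcases hq : D'.loc (.inl q) with s | k
      · refine .strand (highFlag (.src s)) _ (Sum.inr (Sum.inl s)) rfl ?_
          (anchored_high D D' φ (.src s))
        simp [lowFlag, onStrand, hl, hq, upLoc]
      · exact .arc (Sum.inl p) k (by rw [hl, hq]; rfl)
  | edge f _ ih =>
    refine .edge _ ?_
    rw [newMate_low]; exact ih
  | strand f g s hf hg _ ih =>
    have key : ∀ f : Flag S P (Pt w) (Pt w'), onStrand D.loc f = some s →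
        onStrand (newLoc D D' φ) (lowFlag f : Flag _ _ _ (Pt w'')) = some (.inl s) := by
      intro f hf
      rcases f with s | s | p | t | b
      · simp only [onStrand, Option.some.injEq] at hf; subst hf; rfl
      · simp only [onStrand, Option.some.injEq] at hf; subst hf; rfl
      · simp only [onStrand] at hf
        rcases h : D.loc (.inr p) with l | l <;> rw [h] at hf
        · simp only [Sum.getLeft?_inl, Option.some.injEq] at hf; subst hf
          have hp := φ.2 p
          rcases ho : φ.1 p with _ | q
          · obtain ⟨a, s', ha, hs', h'⟩ :=
              newLoc_of_origin_none D D' φ (.inr (.inl p)) (by simp [origin, ho])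
            simp only [base, Option.some.injEq] at ha
            subst ha
            rw [h] at hs'; cases hs'
            simp [lowFlag, onStrand, h']
          · rw [h, ho] at hp; exact hp.elim
        · simp at hf
      · simp [onStrand] at hf
      · simp [onStrand] at hf
    exact .strand _ _ _ (key f hf) (key g hg) ih

/-- The term of the composite of `D` and `D'` that belongs to the choice `φ`. -/
noncomputable def glue :
    Diag (S ⊕ (S' ⊕ Pt w')) (P ⊕ P') (NewQ D D') w w'' where
  passage := newPassage D D'
  loc := newLoc D D' φ
  word := newWord D D' φ
  nodup := newWord_nodup D D' φ
  mem_word := mem_newWord D D' φ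
  mate := newMate D D'
  mate_mate f := by
    rcases low_or_high f with ⟨g, rfl⟩ | ⟨g, rfl⟩
    · rw [newMate_low, newMate_low, D.mate_mate]
    · rw [newMate_high, newMate_high, D'.mate_mate]
  mate_ne f := by
    rcases low_or_high f with ⟨g, rfl⟩ | ⟨g, rfl⟩
    · rw [newMate_low]; exact fun h => D.mate_ne g (low_injective h)
    · rw [newMate_high]; exact fun h => D'.mate_ne g (high_injective h)
  anchored f := by
    rcases low_or_high f with ⟨g, rfl⟩ | ⟨g, rfl⟩
    · exact anchored_low D D' φ g
    · exact anchored_high D D' φ g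

end glue

/-- The identity: arc `j` runs once through handle `j`, and each upper point is joined to the
bottom point below it. -/
def idDiag (w : Obj) : Diag Empty Empty (Handle w) w w where
  passage j := (j, 1)
  loc := Sum.elim (fun j => .inr j) Empty.elim
  word := Sum.elim Empty.elim fun j => [.inl j]
  nodup k := by rcases k with k | k; exacts [k.elim, List.nodup_singleton _]
  mem_word k a := by
    rcases k with k | k
    · exact k.elim
    rcases a with a | a
    · simp
    · exact a.elim
  mate
    | .src s => s.elim
    | .tgt s => s.elim
    | .pin p => p.elim
    | .top t => .bot t
    | .bot t => .top t
  mate_mate f := by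
    rcases f with s | s | p | t | t
    exacts [s.elim, s.elim, p.elim, rfl, rfl]
  mate_ne f := by
    rcases f with s | s | p | t | t
    exacts [s.elim, s.elim, p.elim, by simp, by simp]
  anchored f := by
    rcases f with s | s | p | t | t
    exacts [s.elim, s.elim, p.elim, .edge _ (.bot t), .bot t]

end Diag

/-- A diagram from `w` to `w'` with arbitrary finite sets of strands, pins and passages. -/
structure BDiag (w w' : Obj) : Type 1 where
  S : Type
  P : Type
  Q : Type
  [finS : Finite S]
  [finP : Finite P]
  [finQ : Finite Q]
  diag : Diag S P Q w w'

attribute [instance] BDiag.finS BDiag.finP BDiag.finQ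

noncomputable section

/-- Formal linear combinations of diagrams. -/
abbrev FreeDiag (K : Type u) [Field K] (w w' : Obj) : Type (max 1 u) := BDiag w w' →₀ K

open Classical in
instance {S P Q S' P' Q' : Type} {w w' w'' : Obj} [Finite P] [Finite Q']
    (D : Diag S P Q w w') (D' : Diag S' P' Q' w' w'') : Fintype (D.Choice D') :=
  Fintype.ofFinite _

/-- The term of a composite that belongs to the choice `φ`. -/
abbrev BDiag.glue {w w' w'' : Obj} (D : BDiag w w') (D' : BDiag w' w'') (φ : D.diag.Choice D'.diag) :
    BDiag w w'' :=
  ⟨_, _, _, D.diag.glue D'.diag φ⟩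

/-- The sign of a choice: each pin that is put on a reversed parallel arc contributes `-1`. -/
def BDiag.sgn {w w' w'' : Obj} {D : BDiag w w'} {D' : BDiag w' w''} (φ : D.diag.Choice D'.diag) :
    ℤˣ :=
  ∏ᶠ p, (φ.1 p).elim 1 fun q => (D'.diag.passage q).2

/-- The identity diagram. -/
abbrev BDiag.one (w : Obj) : BDiag w w := ⟨_, _, _, Diag.idDiag w⟩

variable (K : Type u) [Field K]

/-- The composite of two diagrams: stacking, with cabling of `D` along the passages of `D'`. -/
def stack {w w' w'' : Obj} (D : BDiag w w') (D' : BDiag w' w'') : FreeDiag K w w'' :=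
  ∑ φ : D.diag.Choice D'.diag, Finsupp.single (D.glue D' φ) (((BDiag.sgn φ : ℤˣ) : ℤ) : K)

/-- Composition of formal linear combinations. -/
def freeComp {w w' w'' : Obj} :
    FreeDiag K w w' →ₗ[K] FreeDiag K w' w'' →ₗ[K] FreeDiag K w w'' :=
  Finsupp.lsum K fun D => LinearMap.toSpanSingleton K _ (Finsupp.lsum K fun D' =>
    LinearMap.toSpanSingleton K _ (stack K D D'))

theorem freeComp_single {w w' w'' : Obj} (D : BDiag w w') (D' : BDiag w' w'') (a b : K) :
    freeComp K (Finsupp.single D a) (Finsupp.single D' b) = (a * b) • stack K D D' := by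
  simp [freeComp, mul_smul]

/-- Start at `f`, follow `mate`, and run through any number of strands `j` with ends `a j` and
`b j`, in either direction; `Reaches mate a b f g` says that `g` can be met in this way. -/
inductive Reaches {F J : Type} (mate : F → F) (a b : J → F) : F → F → Prop
  | halt (f : F) : Reaches mate a b f (mate f)
  | fwd (f g : F) (j : J) (h : mate f = a j) (h' : Reaches mate a b (b j) g) : Reaches mate a b f g
  | bwd (f g : F) (j : J) (h : mate f = b j) (h' : Reaches mate a b (a j) g) : Reaches mate a b f g

/-- Renaming of half-edges. -/
def Flag.map {S P S' P' T B : Type} (f : S → S') (g : P → P') : Flag S P T B → Flag S' P' T B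
  | .src s => .src (f s)
  | .tgt s => .tgt (f s)
  | .pin p => .pin (g p)
  | .top t => .top t
  | .bot b => .bot b

open Diag

/-- `D` arises from `D'` by renaming strands, pins and passages and by erasing strands `J` that have
no letters, where the two edges at the ends of an erased strand become one edge. -/
structure Smooth {S P Q S' P' Q' J : Type} {w w' : Obj} (D' : Diag S' P' Q' w w')
    (D : Diag S P Q w w') (e : S ⊕ J ≃ S') (r : P ≃ P') : Prop where
  strand : ∀ s, D'.spell (.inl (e (.inl s))) = (D.spell (.inl s)).map (Sum.map id r)
  empty : ∀ j, D'.spell (.inl (e (.inr j))) = []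
  arc : ∀ j, D'.spell (.inr j) = (D.spell (.inr j)).map (Sum.map id r)
  mate : ∀ f, Reaches D'.mate (fun j => Flag.src (e (.inr j))) (fun j => Flag.tgt (e (.inr j)))
    (Flag.map (e ∘ .inl) r f) (Flag.map (e ∘ .inl) r (D.mate f))

/-- A diagram as an element of the free space. -/
abbrev toFree {S P Q : Type} [Finite S] [Finite P] [Finite Q] {w w' : Obj} (D : Diag S P Q w w') :
    FreeDiag K w w' :=
  Finsupp.single ⟨S, P, Q, D⟩ 1

/-- The passage through the same handle in the opposite direction. -/
abbrev invLetter {w : Obj} (x : Handle w × ℤˣ) : Handle w × ℤˣ := (x.1, -x.2)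

open Classical in
/-- The defining relations.  The first four identify different encodings of homotopic diagrams:
`smooth`: renaming, and strands without letters may be inserted into edges and erased;
`transfer`: if the outgoing end of `s` is joined to the incoming end of `t`, the last letter of `s`
may be moved to the front of `t`;
`cancel`: running through a handle forth and back may be erased;
`slide`: a vertex may be pulled back through a handle, which lets the third edge run through it.
The others are the relations of Jacobi diagrams.
`reverse`: reversing a strand changes the cyclic order at each of its trivalent vertices, and AS
gives one sign for each of them;
`rotate`: only the cyclic order of the half-edges at a trivalent vertex matters;
`stu`: if `p` and `q` are adjacent on a solid arc this is STU; if they are adjacent on a dashed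
strand it is IHX. -/
inductive LocalRel : ∀ {w w' : Obj}, FreeDiag K w w' → Prop
  | smooth {w w' : Obj} {S P Q S' P' Q' J : Type} [Finite S] [Finite P] [Finite Q] [Finite S']
      [Finite P'] [Finite Q'] (D' : Diag S' P' Q' w w') (D : Diag S P Q w w') (e : S ⊕ J ≃ S')
      (r : P ≃ P') (h : Smooth D' D e r) : LocalRel (toFree K D' - toFree K D)
  | transfer {w w' : Obj} {S P Q Q' : Type} [Finite S] [Finite P] [Finite Q] [Finite Q']
      (D : Diag S P Q w w') (D' : Diag S P Q' w w') (s t : S) (u v : List (Handle w × ℤˣ ⊕ P))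
      (a : Handle w × ℤˣ ⊕ P) (hst : s ≠ t) (hm : D'.mate = D.mate)
      (hj : D.mate (.tgt s) = .src t)
      (hs : D.spell (.inl s) = u ++ [a]) (ht : D.spell (.inl t) = v)
      (hs' : D'.spell (.inl s) = u) (ht' : D'.spell (.inl t) = a :: v)
      (hl : ∀ l, l ≠ .inl s → l ≠ .inl t → D'.spell l = D.spell l) :
      LocalRel (toFree K D - toFree K D')
  | cancel {w w' : Obj} {S P Q Q' : Type} [Finite S] [Finite P] [Finite Q] [Finite Q']
      (D : Diag S P Q w w') (D' : Diag S P Q' w w') (k : S ⊕ Handle w')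
      (u v : List (Handle w × ℤˣ ⊕ P)) (x : Handle w × ℤˣ) (hm : D'.mate = D.mate)
      (hD : D.spell k = u ++ [.inl x, .inl (invLetter x)] ++ v) (hD' : D'.spell k = u ++ v)
      (hl : ∀ l, l ≠ k → D'.spell l = D.spell l) :
      LocalRel (toFree K D - toFree K D')
  | slide {w w' : Obj} {S P Q Q' : Type} [Finite S] [Finite P] [Finite Q] [Finite Q']
      (D : Diag S P Q w w') (D' : Diag S P Q' w w') (k : S ⊕ Handle w') (t : S) (p : P)
      (u v : List (Handle w × ℤˣ ⊕ P)) (x : Handle w × ℤˣ) (hm : D'.mate = D.mate)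
      (hkt : k ≠ .inl t) (hp : D.mate (.pin p) = .src t)
      (hD : D.spell k = u ++ [.inl x, .inr p] ++ v)
      (hD' : D'.spell k = u ++ [.inr p, .inl x] ++ v)
      (ht : D'.spell (.inl t) = .inl x :: D.spell (.inl t))
      (hl : ∀ l, l ≠ k → l ≠ .inl t → D'.spell l = D.spell l) :
      LocalRel (toFree K D - toFree K D')
  | reverse {w w' : Obj} {S P Q Q' : Type} [Finite S] [Finite P] [Finite Q] [Finite Q']
      (D : Diag S P Q w w') (D' : Diag S P Q' w w') (s : S)
      (hm : ∀ f, D'.mate (Equiv.swap (.src s) (.tgt s) f) =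
        Equiv.swap (.src s) (.tgt s) (D.mate f))
      (hs : D'.spell (.inl s) = (D.spell (.inl s)).reverse.map (Sum.map invLetter id))
      (hl : ∀ l, l ≠ .inl s → D'.spell l = D.spell l) :
      LocalRel (toFree K D - (-1 : K) ^ (D.spell (.inl s)).countP Sum.isRight • toFree K D')
  | rotate {w w' : Obj} {S P Q Q' : Type} [Finite S] [Finite P] [Finite Q] [Finite Q']
      (D : Diag S P Q w w') (D' : Diag S P Q' w w') (s : S) (p : P)
      (hs : D.spell (.inl s) = [.inr p]) (hl : D'.spell = D.spell)
      (hm : ∀ f, D'.mate (Equiv.swap (.src s) (.tgt s) (Equiv.swap (.tgt s) (.pin p) f)) =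
        Equiv.swap (.src s) (.tgt s) (Equiv.swap (.tgt s) (.pin p) (D.mate f))) :
      LocalRel (toFree K D - toFree K D')
  | stu {w w' : Obj} {S P Q Q' Q'' : Type} [Finite S] [Finite P] [Finite Q] [Finite Q'] [Finite Q'']
      (D : Diag S P Q w w') (D' : Diag S P Q' w w') (D'' : Diag S P Q'' w w')
      (k : S ⊕ Handle w') (t : S) (p q : P) (u v : List (Handle w × ℤˣ ⊕ P))
      (hm' : D'.mate = D.mate) (hm'' : D''.mate = D.mate)
      (hkt : k ≠ .inl t) (hp : D.mate (.pin p) = .src t)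
      (hD : D.spell k = u ++ [.inr q, .inr p] ++ v)
      (hD' : D'.spell k = u ++ [.inr p, .inr q] ++ v)
      (hl' : ∀ l, l ≠ k → D'.spell l = D.spell l)
      (hD'' : D''.spell k = u ++ [.inr p] ++ v)
      (ht'' : D''.spell (.inl t) = .inr q :: D.spell (.inl t))
      (hl'' : ∀ l, l ≠ k → l ≠ .inl t → D''.spell l = D.spell l) :
      LocalRel (toFree K D - toFree K D' - toFree K D'')

/-- All linear consequences of the defining relations in diagrams into which they are put by
composition. -/
inductive Rel : ∀ {w w' : Obj}, FreeDiag K w w' → Prop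
  | of {w w' : Obj} (x : FreeDiag K w w') (h : LocalRel K x) : Rel x
  | zero {w w' : Obj} : Rel (0 : FreeDiag K w w')
  | add {w w' : Obj} (x y : FreeDiag K w w') (hx : Rel x) (hy : Rel y) : Rel (x + y)
  | smul {w w' : Obj} (a : K) (x : FreeDiag K w w') (hx : Rel x) : Rel (a • x)
  | post {w w' w'' : Obj} (x : FreeDiag K w w') (y : FreeDiag K w' w'') (hy : Rel y) :
      Rel (freeComp K x y)
  | pre {w w' w'' : Obj} (x : FreeDiag K w w') (y : FreeDiag K w' w'') (hx : Rel x) :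
      Rel (freeComp K x y)

/-- The subspace of the relations. -/
def relations (w w' : Obj) : Submodule K (FreeDiag K w w') where
  carrier := {x | Rel K x}
  zero_mem' := .zero
  add_mem' hx hy := .add _ _ hx hy
  smul_mem' a _ hx := .smul a _ hx

/-! associativity -/

namespace Diag

theorem adm_upLoc {S S' : Type} {w' w'' w''' : Obj} {S₀ P₀ Q₀ : Type}
    (D'' : Diag S₀ P₀ Q₀ w'' w''') (l : S' ⊕ Handle w'') (o : Option Q₀) :
    D''.Adm (upLoc l : (S ⊕ (S' ⊕ Pt w')) ⊕ Handle w'') o ↔ D''.Adm l o := by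
  rcases l with l | l <;> cases o <;> rfl

theorem orient_map {α β : Type} (e : ℤˣ) (l : List α) (f : α → β) :
    (orient e l).map f = orient e (l.map f) := by
  unfold orient; split <;> simp

theorem orient_filterMap {α β : Type} (e : ℤˣ) (l : List α) (f : α → Option β) :
    (orient e l).filterMap f = orient e (l.filterMap f) := by
  unfold orient; split <;> simp

theorem orient_flatMap {α β : Type} (e : ℤˣ) (l : List α) (f : α → List β) :
    orient e (l.flatMap f) = (orient e l).flatMap fun a => orient e (f a) := by
  unfold orient; split
  · rfl
  · rw [List.reverse_flatMap]; rfl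

theorem orient_orient {α : Type} (e e' : ℤˣ) (l : List α) :
    orient e (orient e' l) = orient (e * e') l := by
  rcases Int.units_eq_one_or e with rfl | rfl <;> rcases Int.units_eq_one_or e' with rfl | rfl <;>
    simp [orient]

section assoc

variable {w₀ w₁ w₂ w₃ : Obj} {S₀ P₀ Q₀ S₁ P₁ Q₁ S₂ P₂ Q₂ : Type}
  (f : Diag S₀ P₀ Q₀ w₀ w₁) (g : Diag S₁ P₁ Q₁ w₁ w₂) (h : Diag S₂ P₂ Q₂ w₂ w₃)
  (α : g.Choice h) (β : f.Choice (g.glue h α))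

def fstChoice : f.Choice g :=
  ⟨fun p => (β.1 p).map fun x => x.1.1, fun p => by
    have hβ := β.2 p
    show g.Adm _ ((β.1 p).map fun x => x.1.1)
    rcases hl : f.loc (.inr p) with s | j <;> rcases hb : β.1 p with _ | x <;>
      rw [hl, hb] at hβ
    · trivial
    · exact hβ.elim
    · exact hβ.elim
    · exact hβ⟩

/-- An admissible pair of targets gives an admissible target. -/
theorem adm_pair_iff (φ : f.Choice g) (x : NewQ f g ⊕ (P₀ ⊕ P₁)) (a : Q₀ ⊕ P₀)
    (_hx : base f g x = some a) (o : Option (NewQ g h))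
    (ho : origin f g φ x = (o.map fun y => y.1.1).map .inl) :
    h.Adm (newLoc f g φ x) (o.bind fun y => y.1.2) := by
  rcases o with _ | ⟨⟨q, o⟩, hq⟩
  · obtain ⟨_, s, -, -, h'⟩ := newLoc_of_origin_none f g φ x ho
    rw [h']; trivial
  · rw [newLoc_of_origin f g φ x (.inl q) ho]
    exact (adm_upLoc _ _ _).2 hq

def sndChoice : (f.glue g (fstChoice f g h α β)).Choice h :=
  ⟨Sum.elim (fun p => (β.1 p).bind fun x => x.1.2) α.1, fun p => by
    rcases p with p | p
    · exact adm_pair_iff f g h (fstChoice f g h α β) (.inr (.inl p)) (.inr p) rfl (β.1 p) rfl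
    · exact (adm_upLoc _ _ _).2 (α.2 p)⟩

abbrev psi := sndChoice f g h α β
abbrev phi := fstChoice f g h α β

/-- Labels of items in the two ways of composing three diagrams. -/
abbrev labL : NewQ (f.glue g (phi f g h α β)) h ⊕ ((P₀ ⊕ P₁) ⊕ P₂) →
    (Handle w₀ × ℤˣ) ⊕ ((P₀ ⊕ P₁) ⊕ P₂) :=
  Sum.map (newPassage _ _) id

abbrev labR : NewQ f (g.glue h α) ⊕ (P₀ ⊕ (P₁ ⊕ P₂)) →
    (Handle w₀ × ℤˣ) ⊕ ((P₀ ⊕ P₁) ⊕ P₂) :=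
  Sum.map (newPassage _ _) (Equiv.sumAssoc _ _ _).symm

theorem copy_copy (o : Option (NewQ g h)) (a : Q₀ ⊕ P₀) :
    ((copy f g (phi f g h α β) (o.map fun y => y.1.1) a).bind
      (copy (f.glue g (phi f g h α β)) h (psi f g h α β) (o.bind fun y => y.1.2))).map
        (labL f g h α β) =
    (copy f (g.glue h α) β o a).map (labR f g h α) := by
  rcases a with q | p
  · have hiff : g.Adm (f.loc (.inl q)) (o.map fun y => y.1.1) ↔
        (g.glue h α).Adm (f.loc (.inl q)) o := by
      rcases f.loc (.inl q) with s | j <;> cases o <;> rfl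
    by_cases hq : g.Adm (f.loc (.inl q)) (o.map fun y => y.1.1)
    · have hq' := hiff.1 hq
      have h2 := adm_pair_iff f g h (phi f g h α β) (.inl ⟨(q, _), hq⟩) (.inl q) rfl o rfl
      simp only [copy, dif_pos hq, dif_pos hq', Option.bind_some]
      erw [dif_pos h2]
      simp only [Option.map_some, labL, labR, Sum.map_inl]
      congr 2
      rcases o with _ | ⟨⟨q₁, _ | q₂⟩, hh⟩
      · simp [newPassage, glue]
      · simp [newPassage, glue]
      · simp [newPassage, glue, mul_assoc]
    · have hq' := fun h' => hq (hiff.2 h')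
      simp only [copy, dif_neg hq, dif_neg hq', Option.bind_none, Option.map_none]
  · simp only [copy]
    by_cases hp : β.1 p = o
    · subst hp
      simp [fstChoice, sndChoice, copy]
    · rw [if_neg hp]
      by_cases hp' : (phi f g h α β).1 p = o.map fun y => y.1.1
      · rw [if_pos hp']
        have : (psi f g h α β).1 (.inl p) ≠ o.bind fun y => y.1.2 := by
          intro h'
          apply hp
          simp only [fstChoice, sndChoice, Sum.elim_inl] at hp' h'
          rcases hb : β.1 p with _ | ⟨⟨q, o'⟩, hx⟩ <;> rcases o with _ | ⟨⟨q₁, o₁⟩, hy⟩ <;>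
            simp_all
        simp [copy, this]
      · rw [if_neg hp']; rfl

theorem copy_expand (o : Option Q₂) (a : Q₁ ⊕ P₁) :
    orient (o.elim 1 fun q => (h.passage q).2) (((expand f g (phi f g h α β) a).filterMap
      (copy (f.glue g (phi f g h α β)) h (psi f g h α β) o)).map (labL f g h α β)) =
    ((copy g h α o a).elim [] (expand f (g.glue h α) β)).map (labR f g h α) := by
  rcases a with q | p
  · by_cases hq : h.Adm (g.loc (.inl q)) o
    · have := fun a => copy_copy f g h α β (some ⟨(q, o), hq⟩) a
      simp only [Option.map_some, Option.bind_some] at this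
      simp only [expand, copy, dif_pos hq, Option.elim_some, orient_filterMap,
        List.filterMap_filterMap, orient_map, List.map_filterMap, orient_orient]
      congr 1
      refine List.filterMap_congr fun a _ => this a
    · simp only [copy, dif_neg hq, Option.elim_none, List.map_nil]
      have : (expand f g (phi f g h α β) (.inl q)).filterMap
          (copy (f.glue g (phi f g h α β)) h (psi f g h α β) o) = [] := by
        rw [List.filterMap_eq_nil_iff]
        intro x hx
        rw [mem_expand] at hx
        by_contra hne
        obtain ⟨y, hy⟩ := Option.ne_none_iff_exists'.1 hne
        rw [copy_eq_some] at hy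
        have hadm := adm_of_base _ _ _ y x hy.1 o hy.2
        have hadm' : h.Adm (newLoc f g (phi f g h α β) x) o := hadm
        rw [newLoc_of_origin f g _ x _ hx, adm_upLoc] at hadm'
        exact hq hadm'
      rw [this]
      simp [orient]
  · simp only [expand, copy]
    by_cases hp : α.1 p = o
    · subst hp
      simp [copy, sndChoice, expand, orient]
    · have : (psi f g h α β).1 (.inr p) ≠ o := hp
      simp [copy, this, hp, orient]

theorem filterMap_flatMap' {A B C : Type} (l : List A) (F : A → Option B) (G : B → List C) :
    (l.filterMap F).flatMap G = l.flatMap fun a => (F a).elim [] G := by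
  induction l with
  | nil => rfl
  | cons a l ih => rcases h : F a with _ | b <;> simp [h, ih]

theorem expand_expand (a : Q₂ ⊕ P₂) :
    (expand (f.glue g (phi f g h α β)) h (psi f g h α β) a).map (labL f g h α β) =
    ((expand g h α a).flatMap (expand f (g.glue h α) β)).map (labR f g h α) := by
  rcases a with q | p
  · have := copy_expand f g h α β (some q)
    simp only [Option.elim_some] at this
    simp only [expand]
    have hw : (f.glue g (phi f g h α β)).word (.inr (h.passage q).1) =
      (g.word (.inr (h.passage q).1)).flatMap (expand f g (phi f g h α β)) := rfl
    rw [hw, List.filterMap_flatMap, orient_map, List.map_flatMap, orient_flatMap]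
    simp only [this]
    rw [← orient_filterMap, filterMap_flatMap', List.map_flatMap]
  · simp [expand]

theorem word_word (l : S₁ ⊕ Handle w₂) (o : Option Q₂) (ho : o = none) :
    (((g.word l).flatMap (expand f g (phi f g h α β))).filterMap
      (copy (f.glue g (phi f g h α β)) h (psi f g h α β) o)).map (labL f g h α β) =
    (((g.word l).filterMap (copy g h α o)).flatMap (expand f (g.glue h α) β)).map
      (labR f g h α) := by
  have := copy_expand f g h α β o
  subst ho
  simp only [Option.elim_none, orient, if_true] at this
  rw [List.filterMap_flatMap, List.map_flatMap, filterMap_flatMap', List.map_flatMap]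
  simp only [this]

def assocStrand {X₀ X₁ X₂ L₁ L₂ : Type} :
    (X₀ ⊕ ((X₁ ⊕ (X₂ ⊕ L₂)) ⊕ L₁)) ⊕ Empty ≃ (X₀ ⊕ (X₁ ⊕ L₁)) ⊕ (X₂ ⊕ L₂) where
  toFun
    | .inl (.inl x) => .inl (.inl x)
    | .inl (.inr (.inl (.inl x))) => .inl (.inr (.inl x))
    | .inl (.inr (.inl (.inr x))) => .inr x
    | .inl (.inr (.inr x)) => .inl (.inr (.inr x))
  invFun
    | .inl (.inl x) => .inl (.inl x)
    | .inl (.inr (.inl x)) => .inl (.inr (.inl (.inl x)))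
    | .inr x => .inl (.inr (.inl (.inr x)))
    | .inl (.inr (.inr x)) => .inl (.inr (.inr x))
  left_inv := by rintro ((x | (x | x) | x) | x) <;> first | rfl | exact x.elim
  right_inv := by rintro ((x | x | x) | x) <;> rfl

theorem smooth_assoc :
    Smooth ((f.glue g (phi f g h α β)).glue h (psi f g h α β)) (f.glue (g.glue h α) β)
      assocStrand (Equiv.sumAssoc _ _ _).symm where
  strand := by
    have hR : ∀ l : List (NewQ f (g.glue h α) ⊕ (P₀ ⊕ (P₁ ⊕ P₂))),
        (l.map (Sum.map (newPassage f (g.glue h α)) id)).map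
          (Sum.map id (Equiv.sumAssoc P₀ P₁ P₂).symm) = l.map (labR f g h α) := by
      intro l
      rw [List.map_map, Sum.map_comp_map]; rfl
    rintro (s | (s | s | s) | s) <;> refine Eq.trans ?_ (hR _).symm
    · have := copy_copy f g h α β none
      simp only [Option.map_none, Option.bind_none] at this
      show ((((f.word (.inl s)).filterMap _).filterMap _).map _) =
        ((f.word (.inl s)).filterMap _).map _
      rw [List.filterMap_filterMap, List.map_filterMap, List.map_filterMap]
      exact List.filterMap_congr fun a _ => this a
    · exact word_word f g h α β (.inl s) none rfl
    · show ((h.word (.inl s)).flatMap _).map _ = (((h.word (.inl s)).flatMap _).flatMap _).map _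
      rw [List.flatMap_assoc, List.map_flatMap, List.map_flatMap]
      exact List.flatMap_congr fun a _ => expand_expand f g h α β a
    · rfl
    · rfl
  empty j := j.elim
  arc k := by
    have hR : ∀ l : List (NewQ f (g.glue h α) ⊕ (P₀ ⊕ (P₁ ⊕ P₂))),
        (l.map (Sum.map (newPassage f (g.glue h α)) id)).map
          (Sum.map id (Equiv.sumAssoc P₀ P₁ P₂).symm) = l.map (labR f g h α) := by
      intro l
      rw [List.map_map, Sum.map_comp_map]; rfl
    refine Eq.trans ?_ (hR _).symm
    show ((h.word (.inr k)).flatMap _).map _ = (((h.word (.inr k)).flatMap _).flatMap _).map _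
    rw [List.flatMap_assoc, List.map_flatMap, List.map_flatMap]
    exact List.flatMap_congr fun a _ => expand_expand f g h α β a
  mate x := by
    have hst : ∀ y z, ((f.glue g (phi f g h α β)).glue h (psi f g h α β)).mate y = z →
        Reaches ((f.glue g (phi f g h α β)).glue h (psi f g h α β)).mate
          (fun j => Flag.src (assocStrand (.inr j))) (fun j => Flag.tgt (assocStrand (.inr j)))
          y z := by
      rintro y z rfl; exact .halt y
    apply hst
    rcases low_or_high x with ⟨y, rfl⟩ | ⟨y, rfl⟩
    · have e₁ : ∀ y : Flag S₀ P₀ (Pt w₀) (Pt w₁), Flag.map (assocStrand ∘ .inl)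
          (Equiv.sumAssoc P₀ P₁ P₂).symm (lowFlag y : Flag (S₀ ⊕ ((S₁ ⊕ (S₂ ⊕ Pt w₂)) ⊕ Pt w₁))
            (P₀ ⊕ (P₁ ⊕ P₂)) (Pt w₀) (Pt w₃)) = lowFlag (lowFlag y) := by
        intro y; cases y <;> rfl
      show newMate _ _ _ = Flag.map _ _ (newMate _ _ _)
      rw [newMate_low, e₁, e₁, newMate_low]
      exact congrArg lowFlag (newMate_low _ _ _)
    rcases low_or_high y with ⟨y, rfl⟩ | ⟨y, rfl⟩
    · have e₁ : ∀ y : Flag S₁ P₁ (Pt w₁) (Pt w₂), Flag.map (assocStrand ∘ .inl)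
          (Equiv.sumAssoc P₀ P₁ P₂).symm (highFlag (lowFlag y) :
            Flag (S₀ ⊕ ((S₁ ⊕ (S₂ ⊕ Pt w₂)) ⊕ Pt w₁))
            (P₀ ⊕ (P₁ ⊕ P₂)) (Pt w₀) (Pt w₃)) = lowFlag (highFlag y) := by
        intro y; cases y <;> rfl
      show newMate _ _ _ = Flag.map _ _ (newMate _ _ _)
      rw [newMate_high, e₁, newMate_low]
      rw [show (f.glue g (phi f g h α β)).mate (highFlag y) = highFlag (g.mate y) from
        newMate_high _ _ _, show (g.glue h α).mate (lowFlag y) = lowFlag (g.mate y) from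
        newMate_low _ _ _, e₁]
    · have e₁ : ∀ y : Flag S₂ P₂ (Pt w₂) (Pt w₃), Flag.map (assocStrand ∘ .inl)
          (Equiv.sumAssoc P₀ P₁ P₂).symm (highFlag (highFlag y) :
            Flag (S₀ ⊕ ((S₁ ⊕ (S₂ ⊕ Pt w₂)) ⊕ Pt w₁))
            (P₀ ⊕ (P₁ ⊕ P₂)) (Pt w₀) (Pt w₃)) = highFlag y := by
        intro y; cases y <;> rfl
      show newMate _ _ _ = Flag.map _ _ (newMate _ _ _)
      rw [newMate_high, e₁, newMate_high]
      rw [show (g.glue h α).mate (highFlag y) = highFlag (h.mate y) from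
        newMate_high _ _ _, e₁]

theorem choice_bijective : Function.Bijective
    (fun x : (α : g.Choice h) × f.Choice (g.glue h α) =>
      (⟨phi f g h x.1 x.2, psi f g h x.1 x.2⟩ :
        (φ : f.Choice g) × (f.glue g φ).Choice h)) := by
  constructor
  · rintro ⟨α, β⟩ ⟨α', β'⟩ hx
    simp only [Sigma.mk.injEq] at hx
    obtain ⟨h1, h2⟩ := hx
    have h3 : (psi f g h α β).1 = (psi f g h α' β').1 := by
      have : ∀ φ φ' (x : (f.glue g φ).Choice h) (y : (f.glue g φ').Choice h), φ = φ' → HEq x y →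
          x.1 = y.1 := by
        rintro φ _ x y rfl hxy; rw [eq_of_heq hxy]
      exact this _ _ _ _ h1 h2
    obtain rfl : α = α' := by
      apply Subtype.ext; funext p; exact congrFun h3 (.inr p)
    refine congrArg (Sigma.mk α) (Subtype.ext (funext fun p => ?_))
    have h4 : (β.1 p).map (fun x => x.1.1) = (β'.1 p).map fun x => x.1.1 :=
      congrFun (congrArg Subtype.val h1) p
    have h5 : (β.1 p).bind (fun x => x.1.2) = (β'.1 p).bind fun x => x.1.2 := congrFun h3 (.inl p)
    rcases hb : β.1 p with _ | ⟨⟨q, o⟩, hx⟩ <;> rcases hb' : β'.1 p with _ | ⟨⟨q', o'⟩, hx'⟩ <;>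
      rw [hb, hb'] at h4 h5 <;> simp_all
  · rintro ⟨φ, ψ⟩
    let α : g.Choice h := ⟨fun p => ψ.1 (.inr p), fun p => (adm_upLoc _ _ _).1 (ψ.2 (.inr p))⟩
    have hex : ∀ p, ∃ o : Option (NewQ g h), (o.map fun x => x.1.1) = φ.1 p ∧
        (o.bind fun x => x.1.2) = ψ.1 (.inl p) ∧ (g.glue h α).Adm (f.loc (.inr p)) o := by
      intro p
      have h1 := φ.2 p
      have h2 : h.Adm (newLoc f g φ (.inr (.inl p))) (ψ.1 (.inl p)) := ψ.2 (.inl p)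
      rcases ho : φ.1 p with _ | q
      · refine ⟨none, rfl, ?_, ?_⟩
        · obtain ⟨_, s, -, -, h'⟩ := newLoc_of_origin_none f g φ (.inr (.inl p)) (by simp [origin, ho])
          rw [h'] at h2
          rcases hψ : ψ.1 (.inl p) with _ | q
          · rfl
          · rw [hψ] at h2; exact h2.elim
        · rw [ho] at h1
          rcases hl : f.loc (.inr p) with s | j
          · trivial
          · rw [hl] at h1; exact h1.elim
      · rw [newLoc_of_origin f g φ (.inr (.inl p)) (.inl q) (by simp [origin, ho]), adm_upLoc] at h2
        refine ⟨some ⟨(q, ψ.1 (.inl p)), h2⟩, rfl, rfl, ?_⟩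
        rw [ho] at h1
        rcases hl : f.loc (.inr p) with s | j
        · rw [hl] at h1; exact h1.elim
        · rw [hl] at h1; exact h1
    choose b hb1 hb2 hb3 using hex
    have hφ : phi f g h α ⟨b, hb3⟩ = φ := Subtype.ext (funext hb1)
    refine ⟨⟨α, ⟨b, hb3⟩⟩, ?_⟩
    have : ∀ φ' (x : (f.glue g φ').Choice h), φ' = φ → x.1 = ψ.1 →
        (⟨φ', x⟩ : (φ : f.Choice g) × (f.glue g φ).Choice h) = ⟨φ, ψ⟩ := by
      rintro φ' x rfl hx; rw [Subtype.ext hx]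
    refine this _ _ hφ ?_
    funext p
    rcases p with p | p
    · exact hb2 p
    · rfl

end assoc

section units

variable {S P Q : Type} {w w' : Obj} (D : Diag S P Q w w')

def idChoice : Choice (idDiag w) D := ⟨fun p => p.elim, fun p => p.elim⟩

def choiceId : Choice D (idDiag w') :=
  ⟨fun p => (D.loc (.inr p)).getRight?, fun p => by
    show Adm _ _ (D.loc (.inr p)).getRight?
    rcases D.loc (.inr p) with s | j
    · trivial
    · rfl⟩

theorem expand_idChoice (a : Q ⊕ P) :
    (expand (idDiag w) D (idChoice D) a).map (Sum.map (newPassage _ _) id) =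
      [Sum.map D.passage (Equiv.emptySum Empty P).symm a] := by
  rcases a with q | p
  · have : (idDiag w).word (.inr (D.passage q).1) = [.inl (D.passage q).1] := rfl
    have h : D.Adm ((idDiag w).loc (.inl (D.passage q).1)) (some q) := rfl
    simp only [expand, this, List.filterMap_cons, copy, dif_pos h, List.filterMap_nil, orient]
    have hone : ((idDiag w).passage (D.passage q).1) = ((D.passage q).1, 1) := rfl
    split_ifs <;> simp [newPassage, hone]
  · rfl

theorem word_idChoice (l : List (Q ⊕ P)) :
    (l.flatMap (expand (idDiag w) D (idChoice D))).map (Sum.map (newPassage _ _) id) =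
      (l.map (Sum.map D.passage id)).map (Sum.map id (Equiv.emptySum Empty P).symm) := by
  simp only [List.map_flatMap, expand_idChoice, List.map_map, Sum.map_comp_map]
  induction l with
  | nil => rfl
  | cons a l ih => rw [List.flatMap_cons, ih]; rfl

theorem smooth_idChoice :
    Smooth ((idDiag w).glue D (idChoice D)) D (Equiv.emptySum Empty (S ⊕ Pt w)).symm
      (Equiv.emptySum Empty P).symm where
  strand s := word_idChoice D _
  empty j := rfl
  arc k := word_idChoice D _
  mate x := by
    have e₁ : ∀ y, newMate (idDiag w) D (highFlag y) = highFlag (D.mate y) := newMate_high _ _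
    have key : ∀ y z, D.mate y = z →
        Reaches (newMate (idDiag w) D)
          (fun j => Flag.src ((Equiv.emptySum Empty (S ⊕ Pt w)).symm (.inr j)))
          (fun j => Flag.tgt ((Equiv.emptySum Empty (S ⊕ Pt w)).symm (.inr j)))
          (highFlag y) (Flag.map ((Equiv.emptySum Empty (S ⊕ Pt w)).symm ∘ .inl)
            (Equiv.emptySum Empty P).symm z) := by
      intro y z h
      have e₂ := e₁ y
      rw [h] at e₂
      have hs := Reaches.halt (mate := newMate (idDiag w) D)
          (a := fun j => Flag.src ((Equiv.emptySum Empty (S ⊕ Pt w)).symm (.inr j)))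
          (b := fun j => Flag.tgt ((Equiv.emptySum Empty (S ⊕ Pt w)).symm (.inr j)))
      have hs' : ∀ z', newMate (idDiag w) D (highFlag y) = z' → Reaches _ _ _ _ z' :=
        fun z' hz => (congrArg (Reaches _ _ _ _) hz).mp (hs (highFlag y))
      rcases z with s | s | p | t | b
      · exact hs' _ e₂
      · exact hs' _ e₂
      · exact hs' _ e₂
      · exact .bwd _ _ t e₂ (hs _)
      · exact hs' _ e₂
    rcases x with s | s | p | t | b
    · exact key (.src s) _ rfl
    · exact key (.tgt s) _ rfl
    · exact key (.pin p) _ rfl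
    · exact .fwd _ _ t rfl (key (.top t) _ rfl)
    · exact key (.bot b) _ rfl

theorem copy_choiceId (o : Option (Handle w')) (a : Q ⊕ P) (h : (D.loc a).getRight? = o) :
    (copy D (idDiag w') (choiceId D) o a).map (Sum.map (newPassage _ _) id) =
      some (Sum.map D.passage (Equiv.sumEmpty P Empty).symm a) := by
  subst h
  rcases a with q | p
  · have h : (idDiag w').Adm (D.loc (.inl q)) (D.loc (.inl q)).getRight? := by
      rcases D.loc (.inl q) with s | j
      · trivial
      · rfl
    simp only [copy, dif_pos h, Option.map_some, Sum.map_inl, newPassage]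
    rcases (D.loc (.inl q)).getRight? with _ | j
    · simp
    · simp [show ((idDiag w').passage j) = (j, 1) from rfl]
  · simp [copy, choiceId]

theorem word_choiceId (k : S ⊕ Handle w') :
    ((D.word k).filterMap (copy D (idDiag w') (choiceId D) k.getRight?)).map
      (Sum.map (newPassage _ _) id) =
      ((D.word k).map (Sum.map D.passage id)).map (Sum.map id (Equiv.sumEmpty P Empty).symm) := by
  rw [List.map_filterMap, List.map_map, ← List.filterMap_eq_map]
  refine List.filterMap_congr fun a ha => ?_
  rw [copy_choiceId D _ a (by rw [(D.mem_word _ _).1 ha]), Sum.map_comp_map]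
  rfl

def unitStrand {A B : Type} : A ⊕ B ≃ A ⊕ (Empty ⊕ B) :=
  Equiv.sumCongr (Equiv.refl A) (Equiv.emptySum Empty B).symm

theorem smooth_choiceId :
    Smooth (D.glue (idDiag w') (choiceId D)) D unitStrand (Equiv.sumEmpty P Empty).symm where
  strand s := word_choiceId D (.inl s)
  empty j := rfl
  arc k := by
    refine Eq.trans ?_ (word_choiceId D (.inr k))
    show ([Sum.inl k].flatMap (expand D (idDiag w') (choiceId D))).map
      (Sum.map (newPassage _ _) id) = _
    rw [List.flatMap_singleton]
    rfl
  mate x := by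
    have e₁ : ∀ y, newMate D (idDiag w') (lowFlag y) = lowFlag (D.mate y) := newMate_low _ _
    have key : ∀ y z, D.mate y = z →
        Reaches (newMate D (idDiag w'))
          (fun j => Flag.src ((unitStrand : S ⊕ Pt w' ≃ _) (Sum.inr j)))
          (fun j => Flag.tgt ((unitStrand : S ⊕ Pt w' ≃ _) (Sum.inr j)))
          (lowFlag y) (Flag.map ((unitStrand : S ⊕ Pt w' ≃ _) ∘ Sum.inl) (Equiv.sumEmpty P Empty).symm z) := by
      intro y z h
      have e₂ := e₁ y
      rw [h] at e₂
      have hs := Reaches.halt (mate := newMate D (idDiag w'))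
          (a := fun j => Flag.src ((unitStrand : S ⊕ Pt w' ≃ _) (Sum.inr j)))
          (b := fun j => Flag.tgt ((unitStrand : S ⊕ Pt w' ≃ _) (Sum.inr j)))
      have hs' : ∀ z', newMate D (idDiag w') (lowFlag y) = z' → Reaches _ _ _ _ z' :=
        fun z' hz => (congrArg (Reaches _ _ _ _) hz).mp (hs (lowFlag y))
      rcases z with s | s | p | t | b
      · exact hs' _ e₂
      · exact hs' _ e₂
      · exact hs' _ e₂
      · exact hs' _ e₂
      · exact .fwd _ _ b e₂ (hs _)
    rcases x with s | s | p | t | b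
    · exact key (.src s) _ rfl
    · exact key (.tgt s) _ rfl
    · exact key (.pin p) _ rfl
    · exact key (.top t) _ rfl
    · exact .bwd _ _ b rfl (key (.bot b) _ rfl)

end units
end Diag

theorem stack_assoc {w₀ w₁ w₂ w₃ : Obj} (f : BDiag w₀ w₁) (g : BDiag w₁ w₂) (h : BDiag w₂ w₃) :
    freeComp K (freeComp K (Finsupp.single f 1) (Finsupp.single g 1)) (Finsupp.single h 1) -
      freeComp K (Finsupp.single f 1) (freeComp K (Finsupp.single g 1) (Finsupp.single h 1)) ∈
        relations K w₀ w₃ := by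
  have sgn_eq : ∀ {a b c : Obj} (D : BDiag a b) (D' : BDiag b c) (φ : D.diag.Choice D'.diag)
    [Fintype D.P], BDiag.sgn φ = ∏ p, (φ.1 p).elim 1 fun q => (D'.diag.passage q).2 :=
    fun D D' φ _ => finprod_eq_prod_of_fintype _
  have h1 : freeComp K (freeComp K (Finsupp.single f 1) (Finsupp.single g 1))
      (Finsupp.single h 1) = ∑ x : (φ : f.diag.Choice g.diag) × ((f.glue g φ).diag).Choice h.diag,
        Finsupp.single ((f.glue g x.1).glue h x.2)
          ((((BDiag.sgn x.1 * BDiag.sgn (D := f.glue g x.1) x.2 : ℤˣ) : ℤ) : K)) := by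
    rw [freeComp_single, Fintype.sum_sigma]
    simp only [mul_one, one_smul, stack, map_sum, LinearMap.sum_apply]
    refine Finset.sum_congr rfl fun φ _ => ?_
    rw [freeComp_single, stack, Finset.smul_sum]
    refine Finset.sum_congr rfl fun ψ _ => ?_
    simp
  have h2 : freeComp K (Finsupp.single f 1) (freeComp K (Finsupp.single g 1)
      (Finsupp.single h 1)) = ∑ x : (α : g.diag.Choice h.diag) × f.diag.Choice (g.glue h α).diag,
        Finsupp.single (f.glue (g.glue h x.1) x.2)
          ((((BDiag.sgn x.1 * BDiag.sgn (D' := g.glue h x.1) x.2 : ℤˣ) : ℤ) : K)) := by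
    rw [freeComp_single, Fintype.sum_sigma]
    simp only [mul_one, one_smul, stack, map_sum]
    refine Finset.sum_congr rfl fun φ _ => ?_
    rw [freeComp_single, stack, Finset.smul_sum]
    refine Finset.sum_congr rfl fun ψ _ => ?_
    simp
  have h4 := (choice_bijective f.diag g.diag h.diag).sum_comp fun x =>
    (Finsupp.single ((f.glue g x.1).glue h x.2)
      ((((BDiag.sgn x.1 * BDiag.sgn (D := f.glue g x.1) x.2 : ℤˣ) : ℤ) : K)) : FreeDiag K w₀ w₃)
  rw [h1, h2]
  rw [← h4]
  rw [← Finset.sum_sub_distrib]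
  refine Submodule.sum_mem _ fun x _ => ?_
  obtain ⟨α, β⟩ := x
  have hs : BDiag.sgn (D := f) (D' := g) (phi f.diag g.diag h.diag α β) *
      BDiag.sgn (D := f.glue g (phi f.diag g.diag h.diag α β)) (D' := h)
        (psi f.diag g.diag h.diag α β) =
      BDiag.sgn (D := g) (D' := h) α * BDiag.sgn (D := f) (D' := g.glue h α) β := by
    have := Fintype.ofFinite f.P
    have := Fintype.ofFinite g.P
    let _ : Fintype (f.glue g (phi f.diag g.diag h.diag α β)).P :=
      inferInstanceAs (Fintype (f.P ⊕ g.P))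
    rw [sgn_eq, sgn_eq, sgn_eq, sgn_eq]
    have h3 := Fintype.prod_sum_type (fun p : f.P ⊕ g.P =>
      ((psi f.diag g.diag h.diag α β).1 p).elim 1 fun q => (h.diag.passage q).2)
    refine (congrArg (HMul.hMul _) h3).trans ?_
    rw [← mul_assoc, ← Finset.prod_mul_distrib, mul_comm]
    congr 1
    refine Finset.prod_congr rfl fun p _ => ?_
    show ((β.1 p).map _).elim _ _ * ((β.1 p).bind _).elim _ _ = _
    rcases β.1 p with _ | ⟨⟨q, o⟩, hx⟩
    · simp
    · simp [BDiag.glue, glue, newPassage, mul_comm]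
  dsimp only
  rw [hs]
  have hc : ∀ (D : BDiag w₀ w₃) (a : K), Finsupp.single D a = a • Finsupp.single D 1 := by
    intro D a; simp
  rw [hc, hc (f.glue _ _), ← smul_sub]
  exact Submodule.smul_mem _ _ (Rel.of _ (LocalRel.smooth _ _ _ _
    (smooth_assoc f.diag g.diag h.diag α β)))

theorem one_stack {w w' : Obj} (D : BDiag w w') :
    freeComp K (Finsupp.single (BDiag.one w) 1) (Finsupp.single D 1) - Finsupp.single D 1 ∈
      relations K w w' := by
  have hu : ∀ φ : (BDiag.one w).diag.Choice D.diag, φ = idChoice D.diag :=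
    fun φ => Subtype.ext (funext fun p => p.elim)
  rw [freeComp_single, stack]
  have hsum := Fintype.sum_eq_single (f := fun φ : (BDiag.one w).diag.Choice D.diag =>
    (Finsupp.single ((BDiag.one w).glue D φ) (((BDiag.sgn φ : ℤˣ) : ℤ) : K) : FreeDiag K w w'))
    (idChoice D.diag) fun φ h => (h (hu φ)).elim
  rw [hsum]
  have : BDiag.sgn (D := BDiag.one w) (D' := D) (idChoice D.diag) = 1 := by
    unfold BDiag.sgn
    exact finprod_eq_one_of_forall_eq_one fun p => p.elim
  rw [this]
  simp only [mul_one, one_smul, Units.val_one, Int.cast_one]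
  exact Rel.of _ (LocalRel.smooth _ _ _ _ (smooth_idChoice D.diag))

theorem stack_one {w w' : Obj} (D : BDiag w w') :
    freeComp K (Finsupp.single D 1) (Finsupp.single (BDiag.one w') 1) - Finsupp.single D 1 ∈
      relations K w w' := by
  have hu : ∀ φ : D.diag.Choice (BDiag.one w').diag, φ = choiceId D.diag := by
    refine fun φ => Subtype.ext (funext fun p => ?_)
    have := φ.2 p
    show φ.1 p = (D.diag.loc (.inr p)).getRight?
    rcases hl : D.diag.loc (.inr p) with s | j <;> rcases ho : φ.1 p with _ | k <;>
      rw [hl, ho] at this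
    · rfl
    · exact this.elim
    · exact this.elim
    · exact congrArg some this
  rw [freeComp_single, stack]
  have hsum := Fintype.sum_eq_single (f := fun φ : D.diag.Choice (BDiag.one w').diag =>
    (Finsupp.single (D.glue (BDiag.one w') φ) (((BDiag.sgn φ : ℤˣ) : ℤ) : K) : FreeDiag K w w'))
    (choiceId D.diag) fun φ h => (h (hu φ)).elim
  rw [hsum]
  have : BDiag.sgn (D := D) (D' := BDiag.one w') (choiceId D.diag) = 1 := by
    unfold BDiag.sgn
    refine finprod_eq_one_of_forall_eq_one fun p => ?_
    rcases (choiceId D.diag).1 p with _ | k <;> rfl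
  rw [this]
  simp only [mul_one, one_smul, Units.val_one, Int.cast_one]
  exact Rel.of _ (LocalRel.smooth _ _ _ _ (smooth_choiceId D.diag))

/-- The space of morphisms from `w` to `w'`. -/
abbrev BigHom (w w' : Obj) : Type (max 1 u) := FreeDiag K w w' ⧸ relations K w w'

/-- Composition of morphisms, in the order of the diagrams: first argument first. -/
def bigComp (w w' w'' : Obj) : BigHom K w w' →ₗ[K] BigHom K w' w'' →ₗ[K] BigHom K w w'' :=
  Submodule.liftQ _
    (LinearMap.flip (Submodule.liftQ _
      (LinearMap.flip ((freeComp K).compr₂ (relations K w w'').mkQ)) (fun y hy => by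
        rw [LinearMap.mem_ker]
        ext1 D
        ext
        simp only [LinearMap.comp_apply, LinearMap.flip_apply, LinearMap.compr₂_apply]
        exact (Submodule.Quotient.mk_eq_zero _).2 (Rel.post _ _ hy))))
    (fun x hx => by
      rw [LinearMap.mem_ker]
      refine Submodule.linearMap_qext _ (LinearMap.ext fun y => ?_)
      exact (Submodule.Quotient.mk_eq_zero _).2 (Rel.pre _ _ hx))

theorem bigComp_mk {w w' w'' : Obj} (x : FreeDiag K w w') (y : FreeDiag K w' w'') :
    bigComp K w w' w'' (Submodule.Quotient.mk x) (Submodule.Quotient.mk y) =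
      Submodule.Quotient.mk (freeComp K x y) := rfl

theorem span_induction {w w' : Obj} {p : BigHom K w w' → Prop} (x : BigHom K w w')
    (single : ∀ D, p (Submodule.Quotient.mk (Finsupp.single D 1)))
    (zero : p 0) (add : ∀ x y, p x → p y → p (x + y)) (smul : ∀ (a : K) x, p x → p (a • x)) :
    p x := by
  obtain ⟨x, rfl⟩ := Submodule.Quotient.mk_surjective _ x
  induction x using Finsupp.induction_linear with
  | zero => exact zero
  | add x y hx hy => exact add _ _ hx hy
  | single D a =>
    rw [show (Finsupp.single D a : FreeDiag K w w') = a • Finsupp.single D 1 by simp]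
    exact smul _ _ (single D)

theorem bigComp_assoc {w₀ w₁ w₂ w₃ : Obj} (x : BigHom K w₀ w₁) (y : BigHom K w₁ w₂)
    (z : BigHom K w₂ w₃) :
    bigComp K _ _ _ (bigComp K _ _ _ x y) z = bigComp K _ _ _ x (bigComp K _ _ _ y z) := by
  induction x using span_induction K with
  | zero => simp
  | add x x' hx hx' => simp [hx, hx']
  | smul a x hx => simp [hx]
  | single f =>
  induction y using span_induction K with
  | zero => simp
  | add x x' hx hx' => simp [hx, hx']
  | smul a x hx => simp [hx]
  | single g =>
  induction z using span_induction K with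
  | zero => simp
  | add x x' hx hx' => simp [hx, hx']
  | smul a x hx => simp [hx]
  | single h => exact (Submodule.Quotient.eq _).2 (stack_assoc K f g h)

/-- The identity morphism. -/
def bigId (w : Obj) : BigHom K w w := Submodule.Quotient.mk (Finsupp.single (BDiag.one w) 1)

theorem bigId_comp {w w' : Obj} (x : BigHom K w w') : bigComp K _ _ _ (bigId K w) x = x := by
  induction x using span_induction K with
  | zero => simp
  | add x x' hx hx' => simp [hx, hx']
  | smul a x hx => simp [hx]
  | single D => exact (Submodule.Quotient.eq _).2 (one_stack K D)

theorem bigComp_id {w w' : Obj} (x : BigHom K w w') : bigComp K _ _ _ x (bigId K w') = x := by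
  induction x using span_induction K with
  | zero => simp
  | add x x' hx hx' => simp [hx, hx']
  | smul a x hx => simp [hx]
  | single D => exact (Submodule.Quotient.eq _).2 (stack_one K D)

/-- The category of extended Jacobi diagrams in handlebodies. -/
def AL (_K : Type u) [Field _K] : Type := Obj

instance : Category.{max 1 u} (AL K) where
  Hom w w' := BigHom K w w'
  id w := bigId K w
  comp f g := bigComp K _ _ _ f g
  id_comp f := bigId_comp K f
  comp_id f := bigComp_id K f
  assoc f g h := bigComp_assoc K f g h

instance : Preadditive (AL K) where
  homGroup w w' := inferInstanceAs (AddCommGroup (BigHom K w w'))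
  add_comp _ _ _ f f' g := LinearMap.map_add₂ (bigComp K _ _ _) f f' g
  comp_add _ _ _ f g g' := LinearMap.map_add (bigComp K _ _ _ f) g g'

instance : Linear K (AL K) where
  homModule w w' := inferInstanceAs (Module K (BigHom K w w'))
  smul_comp _ _ _ a f g := LinearMap.map_smul₂ (bigComp K _ _ _) a f g
  comp_smul _ _ _ f a g := LinearMap.map_smul (bigComp K _ _ _ f) a g

/-- The object `H^{⊗ n}`. -/
def AL.hPow (n : ℕ) : AL K := FreeMonoid.of Gen.H ^ n
/-- The object `L^{⊗ n}`. -/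
def AL.lPow (n : ℕ) : AL K := FreeMonoid.of Gen.L ^ n

/-- Jacobi diagrams in handlebodies: the full subcategory on the powers of `H`. -/
abbrev CatA : Type := InducedCategory (AL K) (AL.hPow K)
/-- The linear PROP for Casimir Lie algebras: the full subcategory on the powers of `L`. -/
abbrev CatLieC : Type := InducedCategory (AL K) (AL.lPow K)

section modules

open Opposite

universe v

variable (C : Type) [Category.{v} C] [Preadditive C] [Linear K C]
variable (A : Type) [Category.{v} A] [Preadditive A] [Linear K A]

/-- Modules over a `K`-linear category: `K`-linear functors to `K`-vector spaces. -/
abbrev LinMod : Type _ :=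
  ObjectProperty.FullSubcategory (C := C ⥤ ModuleCat.{v} K) fun F => F.Additive ∧ F.Linear K

variable {C A}

/-- An `(A, C)`-bimodule: a functor of two variables to vector spaces, covariant in `A`,
contravariant in `C`, and `K`-linear in each of them. -/
structure IsBimodule (B : Cᵒᵖ ⥤ A ⥤ ModuleCat.{v} K) : Prop where
  left_additive : ∀ c, (B.obj c).Additive
  left_linear : ∀ c, (B.obj c).Linear K
  right_add : ∀ {c c' : C} (f g : c ⟶ c'), B.map (f + g).op = B.map f.op + B.map g.op
  right_smul : ∀ {c c' : C} (r : K) (f : c ⟶ c'), B.map (r • f).op = r • B.map f.op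

namespace IsBimodule

open TensorProduct

variable {K} {B : Cᵒᵖ ⥤ A ⥤ ModuleCat.{v} K}

section tensor
variable (B)

open Classical in
/-- The relations of the tensor product over `C`: the span of the elements
`(b · f) ⊗ x - b ⊗ (f · x)`. -/
def tensorRel (N : C ⥤ ModuleCat.{v} K) (a : A) :
    Submodule K (DirectSum C fun c => (B.obj (op c)).obj a ⊗[K] N.obj c) :=
  Submodule.span K {z | ∃ (c c' : C) (f : c ⟶ c') (b : (B.obj (op c')).obj a) (x : N.obj c),
    z = DirectSum.lof K C (fun c => (B.obj (op c)).obj a ⊗[K] N.obj c) c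
          ((B.map f.op).app a b ⊗ₜ x) -
        DirectSum.lof K C (fun c => (B.obj (op c)).obj a ⊗[K] N.obj c) c' (b ⊗ₜ N.map f x)}

/-- The value at `a` of the tensor product of `B` and `N` over `C`. -/
abbrev TensorObj (N : C ⥤ ModuleCat.{v} K) (a : A) : Type v :=
  (DirectSum C fun c => (B.obj (op c)).obj a ⊗[K] N.obj c) ⧸ tensorRel B N a

open Classical in
/-- The class of `b ⊗ x`. -/
def tmul (N : C ⥤ ModuleCat.{v} K) (a : A) (c : C) (b : (B.obj (op c)).obj a) (x : N.obj c) :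
    TensorObj B N a :=
  Submodule.Quotient.mk (DirectSum.lof K C (fun c => (B.obj (op c)).obj a ⊗[K] N.obj c) c (b ⊗ₜ x))

theorem tmul_act (N : C ⥤ ModuleCat.{v} K) (a : A) {c c' : C} (f : c ⟶ c')
    (b : (B.obj (op c')).obj a) (x : N.obj c) :
    tmul B N a c ((B.map f.op).app a b) x = tmul B N a c' b (N.map f x) :=
  (Submodule.Quotient.eq _).2 (Submodule.subset_span ⟨c, c', f, b, x, rfl⟩)

theorem tensor_ext {N : C ⥤ ModuleCat.{v} K} {a : A} {X : Type*} [AddCommGroup X] [Module K X]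
    {φ ψ : TensorObj B N a →ₗ[K] X}
    (h : ∀ c b x, φ (tmul B N a c b x) = ψ (tmul B N a c b x)) : φ = ψ := by
  classical
  refine Submodule.linearMap_qext _ (DirectSum.linearMap_ext K fun c => ?_)
  exact TensorProduct.ext' fun b x => h c b x

open Classical in
/-- Linear maps out of the tensor product over `C`. -/
def tensorLift (N : C ⥤ ModuleCat.{v} K) (a : A) {X : Type v} [AddCommGroup X] [Module K X]
    (F : ∀ c, (B.obj (op c)).obj a →ₗ[K] N.obj c →ₗ[K] X)
    (hF : ∀ (c c' : C) (f : c ⟶ c') b x, F c ((B.map f.op).app a b) x = F c' b (N.map f x)) :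
    TensorObj B N a →ₗ[K] X :=
  Submodule.liftQ _ (DirectSum.toModule K C X fun c => TensorProduct.lift (F c)) <| by
    rw [tensorRel, Submodule.span_le]
    rintro z ⟨c, c', f, b, x, rfl⟩
    simp [hF]

theorem tensorLift_tmul (N : C ⥤ ModuleCat.{v} K) (a : A) {X : Type v} [AddCommGroup X]
    [Module K X] (F : ∀ c, (B.obj (op c)).obj a →ₗ[K] N.obj c →ₗ[K] X)
    (hF : ∀ (c c' : C) (f : c ⟶ c') b x, F c ((B.map f.op).app a b) x = F c' b (N.map f x))
    (c b x) : tensorLift B N a F hF (tmul B N a c b x) = F c b x := by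
  classical
  unfold tensorLift tmul
  erw [Submodule.liftQ_apply]
  simp

/-- The class of `b ⊗ x`, as a bilinear map. -/
def tmulₗ (N : C ⥤ ModuleCat.{v} K) (a : A) (c : C) :
    (B.obj (op c)).obj a →ₗ[K] N.obj c →ₗ[K] TensorObj B N a :=
  LinearMap.mk₂ K (tmul B N a c)
    (fun b b' x => by simp [tmul, TensorProduct.add_tmul])
    (fun r b x => by simp [tmul, ← TensorProduct.smul_tmul'])
    (fun b x x' => by simp [tmul, TensorProduct.tmul_add])
    (fun r b x => by simp [tmul])

/-- The map `b ⊗ x ↦ (g · b) ⊗ ν x`. -/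
def tensorMap {N N' : C ⥤ ModuleCat.{v} K} {a a' : A} (g : a ⟶ a') (ν : N ⟶ N') :
    TensorObj B N a →ₗ[K] TensorObj B N' a' :=
  tensorLift B N a (fun c => (tmulₗ B N' a' c).compl₁₂ ((B.obj (op c)).map g).hom (ν.app c).hom)
    (fun c c' f b x => by
      show tmul B N' a' c ((B.obj (op c)).map g ((B.map f.op).app a b)) (ν.app c x) =
        tmul B N' a' c' ((B.obj (op c')).map g b) (ν.app c' (N.map f x))
      rw [NatTrans.naturality_apply, ← tmul_act, NatTrans.naturality_apply])

theorem tensorMap_tmul {N N' : C ⥤ ModuleCat.{v} K} {a a' : A} (g : a ⟶ a') (ν : N ⟶ N')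
    (c b x) : tensorMap B g ν (tmul B N a c b x) =
      tmul B N' a' c ((B.obj (op c)).map g b) (ν.app c x) :=
  tensorLift_tmul B N a _ _ c b x

end tensor

variable (h : IsBimodule K B)

/-- The functor `B ⊗_C -` from `C`-modules to `A`-modules. -/
def tensor : LinMod K C ⥤ LinMod K A where
  obj N :=
    { obj :=
        { obj a := ModuleCat.of K (TensorObj B N.obj a)
          map g := ModuleCat.ofHom (tensorMap B g (𝟙 N.obj))
          map_id a := by
            ext1; refine tensor_ext B fun c b x => ?_
            simp [tensorMap_tmul]
          map_comp f g := by
            ext1; refine tensor_ext B fun c b x => ?_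
            simp [tensorMap_tmul] }
      property := by
        refine ⟨⟨fun {a a' f g} => ?_⟩, ⟨fun {a a'} f r => ?_⟩⟩
        · have := h.left_additive
          ext1; refine tensor_ext B fun c b x => ?_
          simp only [ModuleCat.hom_ofHom, ModuleCat.hom_add, LinearMap.add_apply, tensorMap_tmul,
            Functor.map_add]
          exact LinearMap.map_add₂ (tmulₗ B N.obj a' c) _ _ _
        · have := h.left_linear
          ext1; refine tensor_ext B fun c b x => ?_
          simp only [ModuleCat.hom_ofHom, ModuleCat.hom_smul, LinearMap.smul_apply, tensorMap_tmul,
            Functor.map_smul]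
          exact LinearMap.map_smul₂ (tmulₗ B N.obj a' c) _ _ _ }
  map {N N'} ν := ObjectProperty.homMk
    { app a := ModuleCat.ofHom (tensorMap B (𝟙 a) ν.hom)
      naturality a a' g := by
        refine ModuleCat.hom_ext (tensor_ext B fun c b x => ?_)
        simp [tensorMap_tmul] }
  map_id N := by
    refine ObjectProperty.hom_ext _ (NatTrans.ext (funext fun a => ModuleCat.hom_ext ?_))
    refine tensor_ext B fun c b x => ?_
    exact (tensorMap_tmul B _ _ c b x).trans (by simp)
  map_comp {N N' N''} f g := by
    refine ObjectProperty.hom_ext _ (NatTrans.ext (funext fun a => ModuleCat.hom_ext ?_))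
    refine tensor_ext B fun c b x => ?_
    refine (tensorMap_tmul B _ _ c b x).trans ?_
    refine Eq.trans ?_ (congrArg (tensorMap B (𝟙 a) g.hom) (tensorMap_tmul B _ _ c b x)).symm
    refine Eq.trans ?_ (tensorMap_tmul B _ _ c _ _).symm
    simp

/-- The left `A`-modules `B(c, -)`, contravariant in `c`. -/
def leftModule : Cᵒᵖ ⥤ LinMod K A :=
  ObjectProperty.lift _ B fun c => ⟨h.left_additive c, h.left_linear c⟩

theorem leftModule_add {c c' : C} (f g : c ⟶ c') :
    h.leftModule.map (f + g).op = h.leftModule.map f.op + h.leftModule.map g.op :=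
  ObjectProperty.hom_ext _ (h.right_add f g)

theorem leftModule_smul {c c' : C} (r : K) (f : c ⟶ c') :
    h.leftModule.map (r • f).op = r • h.leftModule.map f.op :=
  ObjectProperty.hom_ext _ (h.right_smul r f)

/-- The functor `Hom_{A-Mod}(B, -)` from `A`-modules to `C`-modules: its value on `M` at `c` is the
space of morphisms of `A`-modules from `B(c, -)` to `M`, and `C` acts by precomposition. -/
def hom : LinMod K A ⥤ LinMod K C where
  obj M :=
    { obj :=
        { obj c := ModuleCat.of K (h.leftModule.obj (op c) ⟶ M)
          map f := ModuleCat.ofHom (Linear.leftComp K M (h.leftModule.map f.op))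
          map_id c := ModuleCat.hom_ext (LinearMap.ext fun φ => by simp)
          map_comp f g := ModuleCat.hom_ext (LinearMap.ext fun φ => by simp) }
      property := by
        refine ⟨⟨fun {c c' f g} => ?_⟩, ⟨fun {c c'} f r => ?_⟩⟩
        · refine ModuleCat.hom_ext (LinearMap.ext fun φ => ?_)
          exact (congrArg (· ≫ φ) (h.leftModule_add f g)).trans (Preadditive.add_comp _ _ _ _ _ _)
        · refine ModuleCat.hom_ext (LinearMap.ext fun φ => ?_)
          exact (congrArg (· ≫ φ) (h.leftModule_smul r f)).trans (Linear.smul_comp _ _ _ _ _ _) }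
  map {M M'} μ := ObjectProperty.homMk
    { app c := ModuleCat.ofHom (Linear.rightComp K _ μ)
      naturality c c' f := ModuleCat.hom_ext (LinearMap.ext fun φ => by simp) }
  map_id M := ObjectProperty.hom_ext _ (NatTrans.ext (funext fun c => ModuleCat.hom_ext
    (LinearMap.ext fun φ => Category.comp_id φ)))
  map_comp μ ν := ObjectProperty.hom_ext _ (NatTrans.ext (funext fun c => ModuleCat.hom_ext
    (LinearMap.ext fun φ => (Category.assoc φ μ ν).symm)))

end IsBimodule
end modules

open Opposite in
/-- The hom-spaces from `L^{⊗ m}` to `H^{⊗ n}`, on which both subcategories act by composition. -/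
def alBifunctor : (CatLieC K)ᵒᵖ ⥤ CatA K ⥤ ModuleCat.{max 1 u} K where
  obj m :=
    { obj n := ModuleCat.of K (AL.lPow K m.unop ⟶ AL.hPow K n)
      map {n n'} g := ModuleCat.ofHom (Linear.rightComp K (AL.lPow K m.unop) g.hom)
      map_id n := ModuleCat.hom_ext (LinearMap.ext fun b => Category.comp_id b)
      map_comp g g' := ModuleCat.hom_ext (LinearMap.ext fun b => (Category.assoc b _ _).symm) }
  map {m m'} f :=
    { app n := ModuleCat.ofHom (Linear.leftComp K (AL.hPow K n) f.unop.hom)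
      naturality n n' g := ModuleCat.hom_ext (LinearMap.ext fun b => (Category.assoc _ b _).symm) }
  map_id m := NatTrans.ext (funext fun n => ModuleCat.hom_ext
    (LinearMap.ext fun b => Category.id_comp b))
  map_comp f g := NatTrans.ext (funext fun n => ModuleCat.hom_ext
    (LinearMap.ext fun b => Category.assoc _ _ b))
end
end ExtJac

/-! This is the tensor-hom adjunction, with rings replaced by `K`-linear categories. A morphism of
`A`-modules out of `B ⊗_C N` and a morphism of `C`-modules from `N` to `Hom(B, M)` carry the same
data: for all `a` and `c`, a bilinear map `B(c, a) × N(c) → M(a)`, natural in `a` and balanced over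
`C`. One side is read as `b ⊗ x ↦ φ (b ⊗ x)`, the other as `x ↦ (b ↦ φ (b ⊗ x))`, and the conditions
on the two sides match. Naturality of `φ` in `a` says that each `b ↦ φ (b ⊗ x)` is a morphism of
`A`-modules. The relation `b · f ⊗ x = b ⊗ f · x` says that `x ↦ (b ↦ φ (b ⊗ x))` commutes with the
action of `C`, since `C` acts on the Hom space by precomposition with its action on `B`.

The constructions `curry` and `uncurry` carry out the two translations. That they are mutually
inverse and natural is an identity between morphisms, which need only be compared on pure tensors
(`tensor_hom_ext`) or on elements of `B` (`leftModule_hom_ext`); there everything reduces to the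
value of `uncurryApp` on a pure tensor, `uncurryApp_tmul`. This gives `tensorHomAdj` for an
arbitrary bimodule.

What remains for Jacobi diagrams is that the spaces of morphisms from powers of `L` to powers of `H`
form a bimodule, `isBimodule_alBifunctor`. For this only the `K`-linear category structure of `AL`
matters: associativity makes the two actions functorial and lets them commute, and bilinearity of
composition makes them linear. -/

namespace ExtJac

namespace IsBimodule

open Opposite CategoryTheory

universe v₁ u₁

variable {K : Type u₁} [Field K] {C : Type} [Category.{v₁} C] [Preadditive C] [Linear K C]
  {A : Type} [Category.{v₁} A] [Preadditive A] [Linear K A] {B : Cᵒᵖ ⥤ A ⥤ ModuleCat.{v₁} K}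

/-! ### Currying, and testing morphisms on elements. -/

/-- The morphism `b ↦ φ (b ⊗ x)` of `A`-modules from `B(c, -)` to `M`. -/
noncomputable def curryApp (h : IsBimodule K B) {N : LinMod K C} {M : LinMod K A} (φ : h.tensor.obj N ⟶ M)
    (c : C) (x : N.obj.obj c) : h.leftModule.obj (op c) ⟶ M :=
  ObjectProperty.homMk
    { app a := ModuleCat.ofHom ((φ.hom.app a).hom ∘ₗ (tmulₗ B N.obj a c).flip x)
      naturality a a' g := ModuleCat.hom_ext (LinearMap.ext fun b => by
        have h1 := NatTrans.naturality_apply φ.hom g (tmul B N.obj a c b x)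
        have h2 := tensorMap_tmul B g (𝟙 N.obj) c b x
        -- On `B ⊗_C N` a morphism `g` of `A` acts through the factor `B` alone, so naturality of
        -- `φ` at the class of `b ⊗ x` is already naturality in `b` with `x` held fixed.
        exact (congrArg (φ.hom.app a') h2).symm.trans h1) }

theorem curryApp_app (h : IsBimodule K B) {N : LinMod K C} {M : LinMod K A}
    (φ : h.tensor.obj N ⟶ M) (c : C) (x : N.obj.obj c) (a : A) (b : (B.obj (op c)).obj a) :
    (curryApp h φ c x).hom.app a b = φ.hom.app a (tmul B N.obj a c b x) :=
  rfl

/-- Morphisms out of `B(c, -)` agree if they agree on elements. -/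
theorem leftModule_hom_ext (h : IsBimodule K B) {M : LinMod K A} {c : C}
    {ψ ψ' : h.leftModule.obj (op c) ⟶ M}
    (H : ∀ (a : A) (b : (B.obj (op c)).obj a), ψ.hom.app a b = ψ'.hom.app a b) : ψ = ψ' :=
  ObjectProperty.hom_ext _ (NatTrans.ext (funext fun a => ModuleCat.hom_ext
    (LinearMap.ext fun b => H a b)))

/-- Morphisms out of `B ⊗_C N` agree if they agree on pure tensors. -/
theorem tensor_hom_ext (h : IsBimodule K B) {N : LinMod K C} {M : LinMod K A}
    {φ ψ : h.tensor.obj N ⟶ M}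
    (H : ∀ a c b x, φ.hom.app a (tmul B N.obj a c b x) = ψ.hom.app a (tmul B N.obj a c b x)) :
    φ = ψ :=
  ObjectProperty.hom_ext _ (NatTrans.ext (funext fun a => ModuleCat.hom_ext
    -- The tensor product is a quotient of a direct sum of ordinary tensor products, hence is
    -- spanned by the classes of pure tensors.
    (tensor_ext B fun c b x => H a c b x)))

/-- The morphism `x ↦ (b ↦ φ (b ⊗ x))` of `C`-modules. -/
noncomputable def curry (h : IsBimodule K B) {N : LinMod K C} {M : LinMod K A} (φ : h.tensor.obj N ⟶ M) :
    N ⟶ h.hom.obj M :=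
  ObjectProperty.homMk
    { app c := ModuleCat.ofHom
        { toFun := fun x => curryApp h φ c x
          -- Sums and multiples of morphisms are computed pointwise, so linearity in `x` may be
          -- tested at each `b`; there it is linearity of `b ⊗ x` in its second variable, followed
          -- by linearity of `φ`.
          map_add' := fun x x' => leftModule_hom_ext h fun a b =>
            (congrArg (φ.hom.app a) (map_add (tmulₗ B N.obj a c b) x x')).trans
              (map_add (φ.hom.app a).hom _ _)
          map_smul' := fun r x => leftModule_hom_ext h fun a b =>
            (congrArg (φ.hom.app a) (map_smul (tmulₗ B N.obj a c b) r x)).trans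
              (map_smul (φ.hom.app a).hom _ _) }
      -- This is where the relation of the tensor product enters: the action of `f` on `N` gives `φ
      -- (b ⊗ f · x)`, precomposition with the action of `f` on `B` gives `φ (b · f ⊗ x)`, and the
      -- two arguments are equal in `B ⊗_C N`.
      naturality _ _ f := ModuleCat.hom_ext (LinearMap.ext fun x =>
        leftModule_hom_ext h fun a b => congrArg (φ.hom.app a) (tmul_act B N.obj a f b x).symm) }

/-! ### Uncurrying. -/

/-- The bilinear map `(b, x) ↦ ψ x b`. -/
noncomputable def eval₂ (h : IsBimodule K B) {N : LinMod K C} {M : LinMod K A} (ψ : N ⟶ h.hom.obj M)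
    (a : A) (c : C) : (B.obj (op c)).obj a →ₗ[K] N.obj.obj c →ₗ[K] M.obj.obj a :=
  LinearMap.mk₂ K
    (fun b x => (ψ.hom.app c x : h.leftModule.obj (op c) ⟶ M).hom.app a b)
    -- The two variables are linear for different reasons. In `b` it is because each component of
    -- the morphism `ψ x` is a linear map.
    (fun b b' x => map_add ((ψ.hom.app c x : h.leftModule.obj (op c) ⟶ M).hom.app a).hom b b')
    (fun r b x => map_smul ((ψ.hom.app c x : h.leftModule.obj (op c) ⟶ M).hom.app a).hom r b)
    -- In `x` it is because `ψ` itself is linear at `c`, and an equality of morphisms `B(c, -) → M`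
    -- may be evaluated at `b`.
    (fun b x x' => congrArg (fun χ : h.leftModule.obj (op c) ⟶ M => χ.hom.app a b)
      (map_add (ψ.hom.app c).hom x x'))
    (fun r b x => congrArg (fun χ : h.leftModule.obj (op c) ⟶ M => χ.hom.app a b)
      (map_smul (ψ.hom.app c).hom r x))

/-- The linear map `b ⊗ x ↦ ψ x b`. -/
noncomputable def uncurryApp (h : IsBimodule K B) {N : LinMod K C} {M : LinMod K A} (ψ : N ⟶ h.hom.obj M)
    (a : A) : TensorObj B N.obj a →ₗ[K] M.obj.obj a :=
  tensorLift B N.obj a (eval₂ h ψ a) fun _ c' f b x =>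
    -- The bilinear maps are balanced: naturality of `ψ` at `f` says that `ψ (f · x)` is `ψ x`
    -- precomposed with the action of `f` on `B`, and evaluating this at `b` gives `ψ (f · x) b = ψ
    -- x (b · f)`.
    congrArg (fun χ : h.leftModule.obj (op c') ⟶ M => χ.hom.app a b)
      (NatTrans.naturality_apply ψ.hom f x).symm

/-- The computation rule to which every later identity is reduced; it keeps those proofs from
unfolding the quotient and the direct sum. -/
theorem uncurryApp_tmul (h : IsBimodule K B) {N : LinMod K C} {M : LinMod K A}
    (ψ : N ⟶ h.hom.obj M) (a : A) (c : C) (b : (B.obj (op c)).obj a) (x : N.obj.obj c) :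
    uncurryApp h ψ a (tmul B N.obj a c b x) =
      (ψ.hom.app c x : h.leftModule.obj (op c) ⟶ M).hom.app a b :=
  tensorLift_tmul B N.obj a _ _ c b x

/-- The morphism `b ⊗ x ↦ ψ x b` of `A`-modules. -/
noncomputable def uncurry (h : IsBimodule K B) {N : LinMod K C} {M : LinMod K A} (ψ : N ⟶ h.hom.obj M) :
    h.tensor.obj N ⟶ M :=
  ObjectProperty.homMk
    { app a := ModuleCat.ofHom (uncurryApp h ψ a)
      naturality a a' g := ModuleCat.hom_ext (tensor_ext B fun c b x => by
        -- Both sides are evaluated on a pure tensor: acting by `g` first gives `ψ x (g · b)`, and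
        -- acting by `g` last gives `g · ψ x b`.
        refine (congrArg (uncurryApp h ψ a') (tensorMap_tmul B g (𝟙 N.obj) c b x)).trans ?_
        refine (uncurryApp_tmul h ψ a' c _ _).trans ?_
        refine Eq.trans ?_ (congrArg (M.obj.map g) (uncurryApp_tmul h ψ a c b x)).symm
        -- These agree because the single morphism `ψ x` is `A`-linear; naturality of `ψ` in `c`
        -- plays no part here, having been spent on the descent to the quotient.
        exact NatTrans.naturality_apply
          (ψ.hom.app c x : h.leftModule.obj (op c) ⟶ M).hom g b) }

/-! ### The adjunction for a general bimodule. -/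

/-- The tensor-hom adjunction of a bimodule. -/
noncomputable def tensorHomAdj (h : IsBimodule K B) : h.tensor ⊣ h.hom :=
  Adjunction.mkOfHomEquiv
    { homEquiv := fun N M =>
        { toFun := curry h
          invFun := uncurry h
          -- Currying only regroups the arguments, so both round trips come down to the same rule
          -- for `uncurryApp` on a pure tensor: here it is read as an identity of maps in `b ⊗ x`,
          -- and in `right_inv` as one in `x` and then `b`.
          left_inv := fun φ => tensor_hom_ext h fun a c b x => uncurryApp_tmul h (curry h φ) a c b x
          right_inv := fun ψ => ObjectProperty.hom_ext _ (NatTrans.ext (funext fun c =>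
            ModuleCat.hom_ext (LinearMap.ext fun x => leftModule_hom_ext h fun a b =>
              uncurryApp_tmul h ψ a c b x))) }
      -- Naturality in `N` is stated for the inverse direction. Both sides send `b ⊗ x` to `ψ (ν x)
      -- b`, up to the identity of `a` acting on `b`, which the final simplification removes.
      homEquiv_naturality_left_symm := fun {N N' M} ν ψ => tensor_hom_ext h fun a c b x => by
        refine (uncurryApp_tmul h (ν ≫ ψ) a c b x).trans ?_
        refine Eq.trans ?_ (congrArg (uncurryApp h ψ a)
          (tensorMap_tmul B (𝟙 a) ν.hom c b x)).symm
        refine Eq.trans ?_ (uncurryApp_tmul h ψ a c _ _).symm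
        simp
      -- Naturality in `M` is definitional: following `φ` by `μ` and then evaluating at `b ⊗ x` is
      -- the same composite as currying `φ` and then postcomposing with `μ`.
      homEquiv_naturality_right := fun _ _ => rfl }

/-- An adjunction by itself does not reveal which bijection of Hom sets it induces. This records
that here it is the expected one, as the theorem demands. -/
theorem tensorHomAdj_homEquiv_app (h : IsBimodule K B) (N : LinMod K C) (M : LinMod K A)
    (φ : h.tensor.obj N ⟶ M) (c : C) (x : N.obj.obj c) (a : A) (b : (B.obj (op c)).obj a) :
    ((h.tensorHomAdj.homEquiv N M φ).hom.app c x : h.leftModule.obj (op c) ⟶ M).hom.app a b =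
      φ.hom.app a (tmul B N.obj a c b x) := by
  -- The bijection of an adjunction is rebuilt from its unit and counit; the rewriting identifies it
  -- with the `curry` that was put in, after which the formula holds by definition.
  rw [tensorHomAdj, Adjunction.mkOfHomEquiv_homEquiv]
  rfl

end IsBimodule

/-! ### The bimodule of extended Jacobi diagrams. -/

/-- All four conditions are bilinearity of composition in `AL`, which passes to the two full
subcategories. That the actions are functorial and commute with each other is already part of
`alBifunctor`. -/
theorem isBimodule_alBifunctor (K : Type u) [Field K] : IsBimodule K (alBifunctor K) where
  -- `CatA` acts by composing after `b`, so linearity in the second factor of a composite is what is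
  -- needed.
  left_additive _ := ⟨fun {_ _ g g'} => ModuleCat.hom_ext (LinearMap.ext fun b =>
    Preadditive.comp_add _ _ _ b g.hom g'.hom)⟩
  left_linear _ := ⟨fun {_ _} g r => ModuleCat.hom_ext (LinearMap.ext fun b =>
    Linear.comp_smul _ _ _ b r g.hom)⟩
  -- `CatLieC` acts by composing before `b`, so linearity in the first factor is needed; equality of
  -- natural transformations is checked at each object and each `b`.
  right_add f g := NatTrans.ext (funext fun _ => ModuleCat.hom_ext (LinearMap.ext fun b =>
    Preadditive.add_comp _ _ _ f.hom g.hom b))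
  right_smul r f := NatTrans.ext (funext fun _ => ModuleCat.hom_ext (LinearMap.ext fun b =>
    Linear.smul_comp _ _ _ r f.hom b))

end ExtJac

theorem theorem4p2 (K : Type u) [Field K] [CharZero K] :
    ∃ h : ExtJac.IsBimodule K (ExtJac.alBifunctor K), ∃ adj : h.tensor ⊣ h.hom,
      ∀ (N : ExtJac.LinMod K (ExtJac.CatLieC K)) (M : ExtJac.LinMod K (ExtJac.CatA K))
        (φ : h.tensor.obj N ⟶ M) (m : ExtJac.CatLieC K) (x : N.obj.obj m) (n : ExtJac.CatA K)
        (b : ExtJac.AL.lPow K m ⟶ ExtJac.AL.hPow K n),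
        ((adj.homEquiv N M φ).hom.app m x : h.leftModule.obj (Opposite.op m) ⟶ M).hom.app n b =
          φ.hom.app n (ExtJac.IsBimodule.tmul (ExtJac.alBifunctor K) N.obj n m b x) := by
  -- A morphism `b` from a power of `L` to a power of `H` is by definition an element of the value
  -- of `alBifunctor`, so the formula for general bimodules applies to it unchanged.
  exact ⟨ExtJac.isBimodule_alBifunctor K, (ExtJac.isBimodule_alBifunctor K).tensorHomAdj,
    fun N M φ m x n b => (ExtJac.isBimodule_alBifunctor K).tensorHomAdj_homEquiv_app N M φ m x n b⟩
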